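/- Let $G$ be a finite simple planar graph, where a graph is planar if it has a topological embedding in $\mathbb{R}^2$: its vertices are mapped to distinct points and its edges to arcs joining the points of their endpoints, such that no arc passes through a vertex other than its endpoints and two distinct arcs meet only in common endpoints. A block of $G$ is a maximal connected subgraph without a cut vertex of its own; the BC-tree $T_2(C)$ of a connected component $C$ of $G$ has as nodes the blocks of $C$ and the cut vertices of $C$, a block $B$ and a cut vertex $c$ being adjacent iff $c\in V(B)$. Let $a$ and $b$ be vertices of the same connected component $C$ of $G$ that lie in no common block, let $B_a$ and $B_b$ be blocks of $C$ with $a\in V(B_a)$ and $b\in V(B_b)$, and let $$B_a,\;c_1,\;B_1,\;c_2,\;\ldots,\;c_k,\;B_k,\;c_{k+1},\;B_b\qquad(k\ge 0)$$ be the path from $B_a$ to $B_b$ in $T_2(C)$, where the $B_i$ are block nodes and the $c_i$ are cut nodes. Then $G+\{\{a,b\}\}$ is planar if and only if (a) $G[V(B_a)]+\{\{a,c_1\}\}$ is planar, (b) $G[V(B_b)]+\{\{c_{k+1},b\}\}$ is planar, and (c) for each $i\in\{1,\ldots,k\}$, $G[V(B_i)]+\{\{c_i,c_{i+1}\}\}$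 is planar. Here $H+\{\{x,y\}\}$ is the graph $H$ with the edge $\{x,y\}$ added; it is $H$ itself if $\{x,y\}$ is already an edge, or if $x=y$ (which can occur when $a=c_1$ or $b=c_{k+1}$). -/

import Mathlib

namespace PlanarBC

/-- The Euclidean plane. -/
abbrev Plane : Type := EuclideanSpace ℝ (Fin 2)

/-- A (topological) planar embedding of a graph: the vertices are mapped to distinct points of the
plane and every edge `{u, v}` to an arc (an injective continuous image of the unit interval) from the
point of `u` to the point of `v`, such that an arc passes through no vertex other than its two
endpoints and two distinct arcs meet only in common endpoints. The values of `arc` on pairs that are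
not edges are irrelevant. -/
structure PlanarEmbedding {V : Type*} (G : SimpleGraph V) where
  point : V → Plane
  arc : Sym2 V → Set Plane
  point_injective : Function.Injective point
  arc_isArc : ∀ u v, G.Adj u v →
    ∃ γ : Path (point u) (point v), Function.Injective γ ∧ Set.range γ = arc s(u, v)
  mem_of_point_mem_arc : ∀ e ∈ G.edgeSet, ∀ w, point w ∈ arc e → w ∈ e
  arc_inter_arc : ∀ e ∈ G.edgeSet, ∀ f ∈ G.edgeSet, e ≠ f →
    ∀ x ∈ arc e ∩ arc f, ∃ w, w ∈ e ∧ w ∈ f ∧ x = point w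

/-- A graph is planar if it has a planar embedding. -/
def IsPlanar {V : Type*} (G : SimpleGraph V) : Prop :=
  Nonempty (PlanarEmbedding G)

/-- `w` is a cut vertex of `G`: some two other vertices are connected in `G` but not in `G - w`.
For connected `G` this says that deleting `w` disconnects `G`; in general it says that `w` is a
cut vertex of its connected component. -/
def IsCutVertex {V : Type*} (G : SimpleGraph V) (w : V) : Prop :=
  ∃ (u v : V) (hu : u ∈ ({w}ᶜ : Set V)) (hv : v ∈ ({w}ᶜ : Set V)),
    G.Reachable u v ∧ ¬ (G.induce ({w}ᶜ : Set V)).Reachable ⟨u, hu⟩ ⟨v, hv⟩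

/-- A graph is biconnected if it is connected and has no cut vertex. (A single vertex and a single
edge count as biconnected here, so that bridges are blocks.) -/
def IsBiconnected {V : Type*} (G : SimpleGraph V) : Prop :=
  G.Connected ∧ ∀ v, ¬ IsCutVertex G v

/-- `B` is the vertex set of a block of `G`, i.e. of a maximal biconnected subgraph. Adding edges
between vertices keeps a graph biconnected, so that such a subgraph is induced by its vertices. -/
def IsBlock {V : Type*} (G : SimpleGraph V) (B : Set V) : Prop :=
  Maximal (fun S : Set V => IsBiconnected (G.induce S)) B

/-- The block nodes of the BC-tree of the connected component `C`. -/
abbrev BlockNode {V : Type*} {G : SimpleGraph V} (C : G.ConnectedComponent) : Type _ :=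
  {B : Set V // IsBlock G B ∧ B ⊆ C.supp}

/-- The cut nodes of the BC-tree of the connected component `C`. -/
abbrev CutNode {V : Type*} {G : SimpleGraph V} (C : G.ConnectedComponent) : Type _ :=
  {v : V // IsCutVertex G v ∧ v ∈ C.supp}

/-- The BC-tree of the connected component `C`: its nodes are the blocks and the cut vertices of
`C`, and a block and a cut vertex are adjacent iff the cut vertex belongs to the block. -/
def bcTree {V : Type*} {G : SimpleGraph V} (C : G.ConnectedComponent) :
    SimpleGraph (BlockNode C ⊕ CutNode C) :=
  SimpleGraph.fromRel fun x y =>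
    ∃ (B : BlockNode C) (c : CutNode C), x = Sum.inl B ∧ y = Sum.inr c ∧ c.1 ∈ B.1

/-- `G[B] + {x, y}` for vertices `x`, `y` of `B`. The graph is `G[B]` itself if `x = y`. -/
def inducePlusEdge {V : Type*} (G : SimpleGraph V) (B : Set V) (x y : V) : SimpleGraph B :=
  G.induce B ⊔ (SimpleGraph.edge x y).induce B

end PlanarBC

open Set Filter Topology Function

namespace PlanarBC

/-! Write `β 0, …, β n` for the blocks on the path and `d 0 = a`, `d 1, …, d n` (the cut vertices),
`d (n + 1) = b`, so that `d j` and `d (j + 1)` both lie in `β j` (`BlockChain`). The claim is that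
`G + ab` is planar iff every `G[β j] + d j d (j + 1)` is.

Necessity (`BlockChain.planarOn_block`): walk from `d j` back through the earlier blocks to `a`,
along the new edge to `b`, and back through the later blocks to `d (j + 1)`. The other blocks of the
chain meet `β j` at most in `d j` or `d (j + 1)`, so this gives a path with inner vertices outside
`β j`. The union of its arcs is one arc, which draws the edge `d j d (j + 1)` (`PlanarOn.suppress`).

Sufficiency (`BlockChain.planarOn_univ`): each component of `G - β j` has at most one neighbour in
`β j`, so the rest of `G` can be attached to `G[β j] + d j d (j + 1)` by 1-sums
(`IsBlock.planarOn_univ`). Then the edges `d 0 d (m + 1)` and `d (m + 1) d (m + 2)`, which lie on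
different sides of the cut vertex `x = d (m + 1)`, are merged into `d 0 d (m + 2)` by a 2-sum at
`x`, for `m = 0, 1, …` (`PlanarOn.twoSum`).

The topology lies in the sums. A Möbius map sends the outside of a small circle around `x` into the
left half plane; `x` is put back at `0` and its edges are reconnected by rays. Two such drawings,
one of them reflected, fit together at `0`. If the map sends to `I` the point where an edge `xu`
leaves the circle, then the remainder of that edge ends at `I`, and the two remainders join there to
an arc from `u` to `v` (`Drawing.exists_twoSum`). This consumes `xu`; if `xu` is also an edge of `G`
it must first be doubled (`Drawing.exists_double`), which is why drawings are of multigraphs. No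
Jordan curve theorem is needed: the parallel copy comes from a finger move (`exists_parallel_arcs`).
-/

/-- `A` is an arc from `p` to `q`. -/
def IsArc {X : Type*} [TopologicalSpace X] (A : Set X) (p q : X) : Prop :=
  ∃ γ : Path p q, Injective γ ∧ range γ = A

/-! ### Arcs: images, concatenation, last exit from a closed set. -/

namespace IsArc

variable {X Y : Type*} [TopologicalSpace X] [TopologicalSpace Y] {A B : Set X} {p q s : X}

theorem symm (h : IsArc A p q) : IsArc A q p := by
  obtain ⟨γ, hγ, rfl⟩ := h
  refine ⟨γ.symm, ?_, Path.symm_range γ⟩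
  intro a b hab
  exact unitInterval.symm_bijective.injective (hγ hab)

theorem left_mem (h : IsArc A p q) : p ∈ A := by
  obtain ⟨γ, -, rfl⟩ := h
  exact ⟨0, γ.source⟩

theorem right_mem (h : IsArc A p q) : q ∈ A := h.symm.left_mem

theorem ne (h : IsArc A p q) : p ≠ q := by
  obtain ⟨γ, hγ, rfl⟩ := h
  intro hpq
  have : γ 0 = γ 1 := by rw [γ.source, γ.target, hpq]
  exact zero_ne_one (hγ this)

theorem isCompact (h : IsArc A p q) : IsCompact A := by
  obtain ⟨γ, -, rfl⟩ := h
  exact isCompact_range γ.continuous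

theorem isPreconnected (h : IsArc A p q) : IsPreconnected A := by
  obtain ⟨γ, -, rfl⟩ := h
  exact isPreconnected_range γ.continuous

theorem image (h : IsArc A p q) {f : X → Y} (hf : ContinuousOn f A) (hi : InjOn f A) :
    IsArc (f '' A) (f p) (f q) := by
  obtain ⟨γ, hγ, rfl⟩ := h
  refine ⟨γ.map' hf, ?_, ?_⟩
  · intro a b hab
    exact hγ (hi ⟨a, rfl⟩ ⟨b, rfl⟩ hab)
  · rw [← range_comp]
    rfl

theorem trans (h : IsArc A p q) (h' : IsArc B q s) (hAB : ∀ z ∈ A, z ∈ B → z = q) :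
    IsArc (A ∪ B) p s := by
  obtain ⟨γ, hγ, rfl⟩ := h
  obtain ⟨δ, hδ, rfl⟩ := h'
  refine ⟨γ.trans δ, ?_, Path.trans_range γ δ⟩
  have key : ∀ a b : unitInterval, (a : ℝ) ≤ 1 / 2 → ¬ (b : ℝ) ≤ 1 / 2 →
      γ.trans δ a ≠ γ.trans δ b := by
    intro a b ha hb hab
    rw [Path.trans_apply, Path.trans_apply, dif_pos ha, dif_neg hb] at hab
    have h1 := hAB _ ⟨_, rfl⟩ ⟨_, hab.symm⟩
    rw [hab] at h1
    have h2 := hδ (h1.trans δ.source.symm)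
    have h3 := congrArg Subtype.val h2
    simp only [Icc.coe_zero] at h3
    push Not at hb
    linarith
  intro a b hab
  by_cases ha : (a : ℝ) ≤ 1 / 2 <;> by_cases hb : (b : ℝ) ≤ 1 / 2
  · rw [Path.trans_apply, Path.trans_apply, dif_pos ha, dif_pos hb] at hab
    have := congrArg Subtype.val (hγ hab)
    exact Subtype.ext (by simpa using this)
  · exact absurd hab (key a b ha hb)
  · exact absurd hab.symm (key b a hb ha)
  · rw [Path.trans_apply, Path.trans_apply, dif_neg ha, dif_neg hb] at hab
    have := congrArg Subtype.val (hδ hab)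
    exact Subtype.ext (by simpa using this)

theorem segment {p q : ℂ} (h : p ≠ q) : IsArc (segment ℝ p q) p q := by
  refine ⟨⟨⟨fun t => AffineMap.lineMap p q (t : ℝ), by fun_prop⟩, by simp, by simp⟩, ?_, ?_⟩
  · intro a b hab
    exact Subtype.ext (AffineMap.lineMap_injective ℝ h hab)
  · rw [segment_eq_image_lineMap]
    ext z
    simp only [Path.coe_mk_mk, mem_range, Subtype.exists, mem_image]
    constructor
    · rintro ⟨t, ht, rfl⟩
      exact ⟨t, ht, rfl⟩
    · rintro ⟨t, ht, rfl⟩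
      exact ⟨t, ht, rfl⟩

/-- The part of an arc after its last point in a closed set. -/
theorem exists_lastExit (h : IsArc A p q) {K : Set X} (hK : IsClosed K) (hp : p ∈ K) (hq : q ∉ K) :
    ∃ (f : X) (B : Set X), f ∈ frontier K ∧ B ⊆ A ∧ IsArc B f q ∧ ∀ z ∈ B, z ∈ K → z = f := by
  obtain ⟨γ, hγ, rfl⟩ := h
  have hc : IsCompact (γ ⁻¹' K) := (hK.preimage γ.continuous).isCompact
  -- The last parameter in `K`; the final part of the arc is `γ` on `[t, 1]`, rescaled by `φ` below.
  obtain ⟨t, htK, htm⟩ := hc.exists_isMaxOn ⟨0, by simpa using hp⟩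
    (continuous_id (X := unitInterval)).continuousOn
  have hmax : ∀ s : unitInterval, t < s → γ s ∉ K := fun s hs hsK => not_le.2 hs (htm hsK)
  have ht1 : t < 1 := by
    refine lt_of_le_of_ne unitInterval.le_one' ?_
    rintro rfl
    exact hq (by simpa using htK)
  have ht1' : (t : ℝ) < 1 := ht1
  have ht0 : (0 : ℝ) ≤ t := t.2.1
  have hmem : ∀ s : unitInterval, (t : ℝ) + (1 - t) * s ∈ Icc (0 : ℝ) 1 := by
    intro s
    have h0 := s.2.1
    have h1 := s.2.2
    constructor
    · nlinarith
    · nlinarith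
  let φ : unitInterval → unitInterval := fun s => ⟨(t : ℝ) + (1 - t) * s, hmem s⟩
  have hφ : Continuous φ := by fun_prop
  have hφi : Injective φ := by
    intro a b hab
    have := congrArg Subtype.val hab
    simp only [φ] at this
    have h2 : (1 - (t : ℝ)) ≠ 0 := by linarith
    exact Subtype.ext (mul_left_cancel₀ h2 (by linarith))
  have hφ0 : φ 0 = t := Subtype.ext (by simp [φ])
  have hφ1 : φ 1 = 1 := Subtype.ext (by simp [φ])
  refine ⟨γ t, range (γ ∘ φ), ?_, range_comp_subset_range φ γ, ?_, ?_⟩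
  -- `γ t` lies in `K` and is a limit of the points `γ s ∉ K` with `s > t`.
  · rw [frontier_eq_closure_inter_closure]
    refine ⟨subset_closure htK, ?_⟩
    have h1 : Tendsto γ (𝓝[>] t) (𝓝 (γ t)) := γ.continuous.continuousWithinAt
    have : (𝓝[>] t).NeBot := nhdsGT_neBot_of_exists_gt ⟨1, ht1⟩
    refine mem_closure_of_tendsto h1 ?_
    filter_upwards [self_mem_nhdsWithin] with s hs using hmax s hs
  · refine ⟨⟨⟨γ ∘ φ, γ.continuous.comp hφ⟩, by simp [hφ0], by simp [hφ1]⟩, hγ.comp hφi, rfl⟩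
  · rintro _ ⟨s, rfl⟩ hsK
    have : t ≤ φ s := Subtype.coe_le_coe.1 (by
      simp only [φ]
      have h0 := s.2.1
      nlinarith)
    rcases this.eq_or_lt with h | h
    · simp [← h]
    · exact absurd hsK (hmax _ h)

end IsArc

/-! ### Drawings of multigraphs and elementary operations on them. -/

/-- A drawing in the complex plane of a multigraph with vertex set `S ⊆ V`, whose edges are indexed
by `E` and have the ends `ends e`. -/
structure Drawing {V E : Type*} (S : Set V) (ends : E → Sym2 V) where
  pt : V → ℂ
  arc : E → Set ℂ
  ends_mem : ∀ e, ∀ w ∈ ends e, w ∈ S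
  injOn : InjOn pt S
  isArc : ∀ e u v, ends e = s(u, v) → IsArc (arc e) (pt u) (pt v)
  mem_ends : ∀ e, ∀ w ∈ S, pt w ∈ arc e → w ∈ ends e
  inter : ∀ e f, e ≠ f → ∀ z ∈ arc e, z ∈ arc f → ∃ w, w ∈ ends e ∧ w ∈ ends f ∧ z = pt w

namespace Drawing

variable {V E F : Type*} {S T : Set V} {ends : E → Sym2 V}

/-- Restriction of a drawing to some of its edges and to a smaller vertex set. -/
noncomputable def comap (D : Drawing S ends) {ends' : F → Sym2 V} (φ : F → E) (hφ : Injective φ)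
    (h : ∀ f, ends (φ f) = ends' f) (hTS : T ⊆ S) (hT : ∀ f, ∀ w ∈ ends' f, w ∈ T) :
    Drawing T ends' where
  pt := D.pt
  arc f := D.arc (φ f)
  ends_mem := hT
  injOn := D.injOn.mono hTS
  isArc f u v hf := D.isArc _ u v ((h f).trans hf)
  mem_ends f w hw hf := h f ▸ D.mem_ends _ w (hTS hw) hf
  inter e f hef z he hf := by
    obtain ⟨w, h1, h2, h3⟩ := D.inter _ _ (hφ.ne hef) z he hf
    exact ⟨w, h e ▸ h1, h f ▸ h2, h3⟩

/-- The image of a drawing under a homeomorphism of the plane. -/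
noncomputable def map (D : Drawing S ends) (h : ℂ ≃ₜ ℂ) : Drawing S ends where
  pt v := h (D.pt v)
  arc e := h '' D.arc e
  ends_mem := D.ends_mem
  injOn _ hu _ hv huv := D.injOn hu hv (h.injective huv)
  isArc e u v he := (D.isArc e u v he).image h.continuous.continuousOn h.injective.injOn
  mem_ends e w hw he := D.mem_ends e w hw (by
    obtain ⟨z, hz, hzw⟩ := he
    exact h.injective hzw ▸ hz)
  inter e f hef := by
    rintro _ ⟨z, hz, rfl⟩ ⟨z', hz', hzz⟩
    obtain rfl := h.injective hzz
    obtain ⟨w, h1, h2, h3⟩ := D.inter e f hef z' hz hz'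
    exact ⟨w, h1, h2, by rw [h3]⟩

/-- Adding an edge along an arc that meets the drawing only in vertices. -/
noncomputable def addEdge (D : Drawing S ends) {u v : V} (hu : u ∈ S) (hv : v ∈ S) {A : Set ℂ}
    (hA : IsArc A (D.pt u) (D.pt v)) (hpt : ∀ w ∈ S, D.pt w ∈ A → w = u ∨ w = v)
    (harc : ∀ e, ∀ z ∈ D.arc e, z ∈ A → ∃ w ∈ ends e, z = D.pt w) :
    Drawing S (fun o : Option E => o.elim s(u, v) ends) where
  pt := D.pt
  arc o := o.elim A D.arc
  ends_mem := by
    rintro (_ | e) w hw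
    · rcases Sym2.mem_iff.1 hw with rfl | rfl <;> assumption
    · exact D.ends_mem e w hw
  injOn := D.injOn
  isArc := by
    rintro (_ | e) a b he
    · rcases Sym2.eq_iff.1 he with ⟨rfl, rfl⟩ | ⟨rfl, rfl⟩
      · exact hA
      · exact hA.symm
    · exact D.isArc e a b he
  mem_ends := by
    rintro (_ | e) w hw he
    · exact Sym2.mem_iff.2 (hpt w hw he)
    · exact D.mem_ends e w hw he
  inter := by
    have key : ∀ e, ∀ z ∈ D.arc e, z ∈ A → ∃ w, w ∈ ends e ∧ w ∈ s(u, v) ∧ z = D.pt w := by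
      intro e z he hz
      obtain ⟨w, hw, rfl⟩ := harc e z he hz
      exact ⟨w, hw, Sym2.mem_iff.2 (hpt w (D.ends_mem e w hw) hz), rfl⟩
    rintro (_ | e) (_ | f) hef z he hf
    · exact absurd rfl hef
    · obtain ⟨w, h1, h2, h3⟩ := key f z hf he
      exact ⟨w, h2, h1, h3⟩
    · exact key e z he hf
    · exact D.inter e f (fun h => hef (by rw [h])) z he hf

open Classical in
/-- Two drawings which share one vertex and are otherwise separated by the imaginary axis. -/
noncomputable def glue (D : Drawing S ends) {ends' : F → Sym2 V} (D' : Drawing T ends') {x : V}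
    (hST : S ∩ T = {x}) (hx : D.pt x = 0) (hx' : D'.pt x = 0)
    (hpt : ∀ v ∈ S, v ≠ x → (D.pt v).re < 0) (hpt' : ∀ v ∈ T, v ≠ x → 0 < (D'.pt v).re)
    (harc : ∀ e, ∀ z ∈ D.arc e, z.re < 0 ∨ z = 0)
    (harc' : ∀ e, ∀ z ∈ D'.arc e, 0 < z.re ∨ z = 0) :
    Drawing (S ∪ T) (Sum.elim ends ends') :=
  have hxS : x ∈ S := (hST.ge rfl).1
  have hxT : x ∈ T := (hST.ge rfl).2
  have hS : ∀ v ∈ S, (if v ∈ S then D.pt v else D'.pt v) = D.pt v := fun v hv => if_pos hv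
  have hT : ∀ v ∈ T, (if v ∈ S then D.pt v else D'.pt v) = D'.pt v := fun v hv => by
    by_cases h : v ∈ S
    · obtain rfl : v = x := hST.le ⟨h, hv⟩
      rw [if_pos h, hx, hx']
    · rw [if_neg h]
  have hle : ∀ v ∈ S, (D.pt v).re < 0 ∨ v = x := fun v hv => by
    by_cases h : v = x
    · exact Or.inr h
    · exact Or.inl (hpt v hv h)
  have hle' : ∀ v ∈ T, 0 < (D'.pt v).re ∨ v = x := fun v hv => by
    by_cases h : v = x
    · exact Or.inr h
    · exact Or.inl (hpt' v hv h)
  have hx0 : ∀ v ∈ S, D.pt v = 0 → v = x := fun v hv h => D.injOn hv hxS (h.trans hx.symm)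
  have hx0' : ∀ v ∈ T, D'.pt v = 0 → v = x := fun v hv h => D'.injOn hv hxT (h.trans hx'.symm)
  have cross : ∀ z : ℂ, (z.re < 0 ∨ z = 0) → (0 < z.re ∨ z = 0) → z = 0 := fun z h h' => by
    rcases h with h | h
    · rcases h' with h' | h'
      · linarith
      · exact h'
    · exact h
  -- Arcs of the two drawings lie in opposite open half planes apart from `0`, the point of `x`.
  have hcross : ∀ e f, ∀ z ∈ D.arc e, z ∈ D'.arc f → z = 0 ∧ x ∈ ends e ∧ x ∈ ends' f :=
    fun e f z he hf => by
      have h0 := cross z (harc e z he) (harc' f z hf)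
      subst h0
      exact ⟨rfl, D.mem_ends e x hxS (hx ▸ he), D'.mem_ends f x hxT (hx' ▸ hf)⟩
  { pt := fun v => if v ∈ S then D.pt v else D'.pt v
    arc := Sum.elim D.arc D'.arc
    ends_mem := by
      rintro (e | e) w hw
      · exact Or.inl (D.ends_mem e w hw)
      · exact Or.inr (D'.ends_mem e w hw)
    injOn := by
      have h2 : ∀ u ∈ S, ∀ v ∈ T, D.pt u = D'.pt v → u = v := by
        intro u hu v hv huv
        have h0 : D.pt u = 0 := by
          rcases hle u hu with h | h
          · rcases hle' v hv with h' | h'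
            · rw [huv] at h
              linarith
            · rw [huv, h', hx']
          · rw [h, hx]
        rw [hx0 u hu h0, hx0' v hv (huv ▸ h0)]
      rintro u (hu | hu) v (hv | hv) huv
      · simp only [hS u hu, hS v hv] at huv
        exact D.injOn hu hv huv
      · simp only [hS u hu, hT v hv] at huv
        exact h2 u hu v hv huv
      · simp only [hT u hu, hS v hv] at huv
        exact (h2 v hv u hu huv.symm).symm
      · simp only [hT u hu, hT v hv] at huv
        exact D'.injOn hu hv huv
    isArc := by
      rintro (e | e) u v he
      · rw [hS u (D.ends_mem e u (by simp_all)), hS v (D.ends_mem e v (by simp_all))]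
        exact D.isArc e u v he
      · rw [hT u (D'.ends_mem e u (by simp_all)), hT v (D'.ends_mem e v (by simp_all))]
        exact D'.isArc e u v he
    mem_ends := by
      rintro (e | e) w (hw | hw) he
      · rw [hS w hw] at he
        exact D.mem_ends e w hw he
      · rw [hT w hw] at he
        have h0 : D'.pt w = 0 := by
          rcases hle' w hw with h | h
          · exact cross _ (harc e _ he) (Or.inl h)
          · rw [h, hx']
        obtain rfl := hx0' w hw h0
        rw [h0] at he
        exact D.mem_ends e w hxS (hx ▸ he)
      · rw [hS w hw] at he
        have h0 : D.pt w = 0 := by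
          rcases hle w hw with h | h
          · exact cross _ (Or.inl h) (harc' e _ he)
          · rw [h, hx]
        obtain rfl := hx0 w hw h0
        rw [h0] at he
        exact D'.mem_ends e w hxT (hx' ▸ he)
      · rw [hT w hw] at he
        exact D'.mem_ends e w hw he
    inter := by
      rintro (e | e) (f | f) hef z he hf
      · obtain ⟨w, h1, h2, h3⟩ := D.inter e f (fun h => hef (by rw [h])) z he hf
        exact ⟨w, h1, h2, by rw [hS w (D.ends_mem e w h1), h3]⟩
      · obtain ⟨h0, h1, h2⟩ := hcross e f z he hf
        exact ⟨x, h1, h2, by rw [hS x hxS, hx, h0]⟩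
      · obtain ⟨h0, h1, h2⟩ := hcross f e z hf he
        exact ⟨x, h2, h1, by rw [hS x hxS, hx, h0]⟩
      · obtain ⟨w, h1, h2, h3⟩ := D'.inter e f (fun h => hef (by rw [h])) z he hf
        exact ⟨w, h1, h2, by rw [hT w (D'.ends_mem e w h1), h3]⟩ }

end Drawing

/-! ### Planarity of induced subgraphs in terms of drawings. -/

/-- The edges of `H` with both ends in `S`. -/
abbrev EdgesIn {V : Type*} (H : SimpleGraph V) (S : Set V) : Type _ :=
  {e : Sym2 V // e ∈ H.edgeSet ∧ ∀ w ∈ e, w ∈ S}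

/-- The graph `H[S]` has a drawing in the complex plane. -/
def PlanarOn {V : Type*} (S : Set V) (H : SimpleGraph V) : Prop :=
  Nonempty (Drawing S (Subtype.val : EdgesIn H S → Sym2 V))

section Planar

variable {V : Type*} {H H' : SimpleGraph V} {S T : Set V}

/-- The drawing may have superfluous vertices and edges, also parallel ones: one index is chosen for
each edge needed, and the choice is injective because the ends determine the edge. -/
theorem PlanarOn.of_drawing {E : Type*} {ends : E → Sym2 V} (D : Drawing T ends) (hST : S ⊆ T)
    (h : ∀ e ∈ H.edgeSet, (∀ w ∈ e, w ∈ S) → ∃ f, ends f = e) : PlanarOn S H := by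
  choose φ hφ using fun e : EdgesIn H S => h e.1 e.2.1 e.2.2
  refine ⟨D.comap φ ?_ hφ hST (fun e => e.2.2)⟩
  intro e f hef
  have := congrArg ends hef
  rw [hφ e, hφ f] at this
  exact Subtype.ext this

theorem PlanarOn.mono (h : PlanarOn T H) (hST : S ⊆ T)
    (hH : ∀ u ∈ S, ∀ v ∈ S, H'.Adj u v → H.Adj u v) : PlanarOn S H' := by
  obtain ⟨D⟩ := h
  refine PlanarOn.of_drawing D hST ?_
  intro e
  induction e with
  | h u v =>
    intro he hw
    exact ⟨⟨s(u, v), hH u (hw u (by simp)) v (hw v (by simp)) he, fun w h => hST (hw w h)⟩, rfl⟩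

theorem isPlanar_induce_iff : IsPlanar (H.induce S) ↔ PlanarOn S H := by
  classical
  let L := Complex.orthonormalBasisOneI.repr
  constructor
  · rintro ⟨P⟩
    let sub : ∀ e : Sym2 V, (∀ w ∈ e, w ∈ S) → Sym2 S := fun e he => e.attachWith he
    have hsub : ∀ e he, (sub e he).map Subtype.val = e := fun e he => Sym2.attachWith_map_subtypeVal he
    have hinj : Injective (Sym2.map (Subtype.val : S → V)) :=
      Sym2.map.injective Subtype.val_injective
    have hmem : ∀ e he w, (∃ h : w ∈ S, (⟨w, h⟩ : S) ∈ sub e he) ↔ w ∈ e := by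
      intro e he w
      conv_rhs => rw [← hsub e he]
      simp [Sym2.mem_map]
    have hedge : ∀ e he, e ∈ H.edgeSet → sub e he ∈ (H.induce S).edgeSet := by
      intro e he h
      obtain ⟨e', rfl⟩ : ∃ e' : Sym2 S, e'.map Subtype.val = e := ⟨_, hsub e he⟩
      have : sub _ he = e' := hinj (hsub _ he)
      rw [this]
      induction e' with
      | h u v => exact h
    let pt : V → ℂ := fun v => if h : v ∈ S then L.symm (P.point ⟨v, h⟩) else 0
    have hpt : ∀ v (h : v ∈ S), pt v = L.symm (P.point ⟨v, h⟩) := fun v h => dif_pos h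
    refine ⟨⟨pt, fun e => L.symm '' P.arc (sub e.1 e.2.2), fun e => e.2.2, ?_, ?_, ?_, ?_⟩⟩
    · intro u hu v hv huv
      rw [hpt u hu, hpt v hv] at huv
      exact congrArg Subtype.val (P.point_injective (L.symm.injective huv))
    · rintro ⟨e, he, heS⟩ u v rfl
      have hu : u ∈ S := heS u (by simp)
      have hv : v ∈ S := heS v (by simp)
      rw [hpt u hu, hpt v hv]
      have : sub s(u, v) heS = s(⟨u, hu⟩, ⟨v, hv⟩) := hinj (hsub _ _)
      rw [this]
      exact IsArc.image (P.arc_isArc ⟨u, hu⟩ ⟨v, hv⟩ he) L.symm.continuous.continuousOn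
        L.symm.injective.injOn
    · rintro ⟨e, he, heS⟩ w hw ⟨z, hz, hzw⟩
      rw [hpt w hw] at hzw
      obtain rfl := L.symm.injective hzw
      exact (hmem e heS w).1 ⟨hw, P.mem_of_point_mem_arc _ (hedge e heS he) _ hz⟩
    · rintro ⟨e, he, heS⟩ ⟨f, hf, hfS⟩ hef _ ⟨z, hz, rfl⟩ ⟨z', hz', hzz⟩
      obtain rfl := L.symm.injective hzz
      obtain ⟨w, h1, h2, h3⟩ := P.arc_inter_arc _ (hedge e heS he) _ (hedge f hfS hf)
        (fun h => hef (Subtype.ext ((hsub e heS).symm.trans ((congrArg _ h).trans (hsub f hfS))))) z' ⟨hz, hz'⟩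
      exact ⟨w, (hmem e heS w).1 ⟨w.2, h1⟩, (hmem f hfS w).1 ⟨w.2, h2⟩, by rw [hpt w w.2, h3]⟩
  · rintro ⟨D⟩
    have hS : ∀ e : Sym2 S, ∀ w ∈ e.map Subtype.val, w ∈ S := by
      intro e w hw
      obtain ⟨a, -, rfl⟩ := Sym2.mem_map.1 hw
      exact a.2
    have hadj : ∀ e ∈ (H.induce S).edgeSet, e.map Subtype.val ∈ H.edgeSet := by
      intro e
      induction e with
      | h u v => exact id
    let up : ∀ e : Sym2 S, e ∈ (H.induce S).edgeSet → EdgesIn H S := fun e he =>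
      ⟨e.map Subtype.val, hadj e he, hS e⟩
    have hup : ∀ e he (w : S), w.1 ∈ (up e he).1 ↔ w ∈ e := by
      intro e he w
      simp [up, Sym2.mem_map]
    let arc : Sym2 S → Set Plane := fun e =>
      if he : e ∈ (H.induce S).edgeSet then L '' D.arc (up e he) else ∅
    have harc : ∀ e he, arc e = L '' D.arc (up e he) := fun e he => dif_pos he
    refine ⟨⟨fun v => L (D.pt v), arc, ?_, ?_, ?_, ?_⟩⟩
    · intro u v huv
      exact Subtype.ext (D.injOn u.2 v.2 (L.injective huv))
    · intro u v huv
      have he : s(u, v) ∈ (H.induce S).edgeSet := huv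
      rw [harc _ he]
      exact (D.isArc (up _ he) u v rfl).image L.continuous.continuousOn L.injective.injOn
    · intro e he w hw
      rw [harc e he] at hw
      obtain ⟨z, hz, hzw⟩ := hw
      obtain rfl := L.injective hzw
      exact (hup e he w).1 (D.mem_ends _ w w.2 hz)
    · intro e he f hf hef z hz
      rw [harc e he, harc f hf] at hz
      obtain ⟨⟨z, hz, rfl⟩, z', hz', hzz⟩ := hz
      obtain rfl := L.injective hzz
      have hne : up e he ≠ up f hf := fun h =>
        hef (Sym2.map.injective Subtype.val_injective (congrArg Subtype.val h))
      obtain ⟨w, h1, h2, h3⟩ := D.inter _ _ hne z' hz hz'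
      have hw : w ∈ S := hS e w h1
      exact ⟨⟨w, hw⟩, (hup e he ⟨w, hw⟩).1 h1, (hup f hf ⟨w, hw⟩).1 h2, by rw [h3]⟩

end Planar

/-! ### Removing a small disc around a vertex. -/

/-- The part of a drawing outside of a small disc around the vertex `x`: an edge `e` at `x` leaves
the disc for the last time at `foot e` and continues along `tail e`. -/
structure Truncation {V E : Type*} {S : Set V} {ends : E → Sym2 V} (D : Drawing S ends) (x : V) where
  r : ℝ
  foot : E → ℂ
  tail : E → Set ℂ
  r_pos : 0 < r
  lt_dist_pt : ∀ w ∈ S, w ≠ x → r < dist (D.pt w) (D.pt x)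
  lt_dist_arc : ∀ e, x ∉ ends e → ∀ z ∈ D.arc e, r < dist z (D.pt x)
  isArc_tail : ∀ e y, ends e = s(x, y) → IsArc (tail e) (foot e) (D.pt y)
  tail_subset : ∀ e, x ∈ ends e → tail e ⊆ D.arc e
  dist_foot : ∀ e, x ∈ ends e → dist (foot e) (D.pt x) = r
  tail_outside : ∀ e, x ∈ ends e → ∀ z ∈ tail e, dist z (D.pt x) ≤ r → z = foot e

theorem eventually_lt_dist_of_isClosed {A : Set ℂ} (hA : IsClosed A) {p : ℂ} (hp : p ∉ A) :
    ∀ᶠ r : ℝ in 𝓝[>] 0, ∀ z ∈ A, r < dist z p := by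
  obtain ⟨ε, hε, h⟩ := Metric.isOpen_iff.1 hA.isOpen_compl p hp
  filter_upwards [Ioo_mem_nhdsGT hε] with r hr z hz
  by_contra hlt
  exact h (Metric.mem_ball.2 (by linarith [hr.2])) hz

namespace Drawing

variable {V E : Type*} {S : Set V} {ends : E → Sym2 V}

/-- Finitely many closed sets miss the point of `x`, so every small radius works; the tails are the
parts of the arcs after their last exit from the closed disc. -/
theorem exists_truncation [Finite V] [Finite E] (D : Drawing S ends) {x : V} (hx : x ∈ S) :
    Nonempty (Truncation D x) := by
  have h1 : ∀ᶠ r : ℝ in 𝓝[>] 0, ∀ w, w ∈ S → w ≠ x → r < dist (D.pt w) (D.pt x) := by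
    refine eventually_all.2 fun w => ?_
    by_cases h : w ∈ S ∧ w ≠ x
    · have : D.pt x ∉ ({D.pt w} : Set ℂ) := fun h' => h.2 (D.injOn h.1 hx h'.symm)
      filter_upwards [eventually_lt_dist_of_isClosed isClosed_singleton this] with r hr _ _
        using hr _ rfl
    · exact Eventually.of_forall fun r h1 h2 => absurd ⟨h1, h2⟩ h
  have h2 : ∀ᶠ r : ℝ in 𝓝[>] 0, ∀ e, x ∉ ends e → ∀ z ∈ D.arc e, r < dist z (D.pt x) := by
    refine eventually_all.2 fun e => ?_
    by_cases h : x ∈ ends e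
    · exact Eventually.of_forall fun r h' => absurd h h'
    · have hc : IsClosed (D.arc e) := by
        obtain ⟨u, v, huv⟩ : ∃ u v, ends e = s(u, v) := by
          induction ends e with
          | h u v => exact ⟨u, v, rfl⟩
        exact (D.isArc e u v huv).isCompact.isClosed
      filter_upwards [eventually_lt_dist_of_isClosed hc fun h' => h (D.mem_ends e x hx h')]
        with r hr _ using hr
  obtain ⟨r, ⟨h1, h2⟩, hr⟩ := ((h1.and h2).and self_mem_nhdsWithin).exists
  have hr : 0 < r := hr
  have h3 : ∀ e, ∃ (f : ℂ) (B : Set ℂ), ∀ y, ends e = s(x, y) →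
      f ∈ Metric.sphere (D.pt x) r ∧ B ⊆ D.arc e ∧ IsArc B f (D.pt y) ∧
        ∀ z ∈ B, z ∈ Metric.closedBall (D.pt x) r → z = f := by
    intro e
    by_cases h : ∃ y, ends e = s(x, y)
    · obtain ⟨y, hy⟩ := h
      have hyS : y ∈ S := D.ends_mem e y (by simp [hy])
      have hA := D.isArc e x y hy
      have hyx : y ≠ x := fun h => hA.ne (by rw [h])
      obtain ⟨f, B, hf, hB, hBf, hz⟩ := hA.exists_lastExit (K := Metric.closedBall (D.pt x) r)
        Metric.isClosed_closedBall (Metric.mem_closedBall_self hr.le)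
        (fun h => absurd (Metric.mem_closedBall.1 h) (not_le.2 (h1 y hyS hyx)))
      refine ⟨f, B, fun y' hy' => ?_⟩
      obtain rfl : y = y' := by
        rw [hy] at hy'
        exact Sym2.congr_right.1 hy'
      exact ⟨Metric.frontier_closedBall_subset_sphere hf, hB, hBf, hz⟩
    · exact ⟨0, ∅, fun y hy => absurd ⟨y, hy⟩ h⟩
  choose foot tail h using h3
  refine ⟨⟨r, foot, tail, hr, h1, h2, fun e y he => (h e y he).2.2.1, ?_, ?_, ?_⟩⟩
  · rintro e ⟨y, hy⟩
    exact (h e y hy).2.1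
  · rintro e ⟨y, hy⟩
    exact (h e y hy).1
  · rintro e ⟨y, hy⟩
    exact (h e y hy).2.2.2

end Drawing

/-! ### The Möbius map into the half plane, and rays to infinity. -/

section HalfPlane

open Complex

/-- The Möbius transformation that maps the outside of the circle around `o` through `o + a` to the
inside of a circle in the left half plane, with `o + a ↦ I`. -/
noncomputable def halfMap (o a z : ℂ) : ℂ := (a / (z - o) - 1 - I)⁻¹

/-- The image under `w ↦ (w - I)⁻¹` of the ray `{s * g | 1 ≤ s ≤ ∞}`. -/
noncomputable def rayImage (g : ℂ) : Set ℂ := (fun t : ℝ => (t : ℂ) / (g - t * I)) '' Icc 0 1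

/-- For `w = a / (z - o) - 1`, the bound `|a / (z - o)| ≤ 1` places `w` in the closed disc `|w + 1|
≤ 1`, which is `|w|² ≤ -2 Re w`. This disc touches the imaginary axis at `0`, the image of `o + a`.
-/
theorem normSq_le_of_outside {o a z : ℂ} (ha : a ≠ 0) (h : ‖a‖ ≤ dist z o) :
    normSq (a / (z - o) - 1) ≤ -2 * (a / (z - o) - 1).re := by
  have h0 : 0 < ‖a‖ := norm_pos_iff.2 ha
  rw [Complex.dist_eq] at h
  have h1 : ‖a / (z - o)‖ ≤ 1 := by
    rw [norm_div]
    exact (div_le_one (h0.trans_le h)).2 h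
  have h2 : normSq (a / (z - o)) ≤ 1 := by
    rw [normSq_eq_norm_sq]
    nlinarith [norm_nonneg (a / (z - o))]
  rw [normSq_apply] at h2 ⊢
  simp only [sub_re, sub_im, one_re, one_im]
  nlinarith

theorem normSq_eq_of_dist_eq {o a z : ℂ} (ha : a ≠ 0) (h : dist z o = ‖a‖) :
    normSq (a / (z - o) - 1) = -2 * (a / (z - o) - 1).re := by
  have h0 : 0 < ‖a‖ := norm_pos_iff.2 ha
  rw [Complex.dist_eq] at h
  have h1 : ‖a / (z - o)‖ = 1 := by
    rw [norm_div, h]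
    exact div_self h0.ne'
  have h2 : normSq (a / (z - o)) = 1 := by
    rw [normSq_eq_norm_sq, h1]
    norm_num
  rw [normSq_apply] at h2 ⊢
  simp only [sub_re, sub_im, one_re, one_im]
  nlinarith

theorem sub_I_ne_zero_of_normSq_le {w : ℂ} (h : normSq w ≤ -2 * w.re) : w - I ≠ 0 := by
  intro h'
  rw [sub_eq_zero.1 h'] at h
  norm_num [normSq_apply] at h

theorem re_neg_of_normSq_le {w : ℂ} (h : normSq w ≤ -2 * w.re) (hw : w ≠ 0) : w.re < 0 := by
  have := normSq_pos.2 hw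
  linarith

theorem re_inv_sub_I_neg {w : ℂ} (hw : w.re < 0) : ((w - I)⁻¹).re < 0 := by
  have h0 : w - I ≠ 0 := fun h => by
    have := congrArg re h
    simp only [sub_re, I_re, zero_re, sub_zero] at this
    linarith
  rw [inv_re]
  refine div_neg_of_neg_of_pos ?_ (normSq_pos.2 h0)
  simpa using hw

theorem ray_denominator_ne_zero {g : ℂ} (hg : g.re < 0) (t : ℝ) : g - t * I ≠ 0 := fun h => by
  have := congrArg re h
  simp at this
  linarith

/-- The circle `|g|² = -2 Re g` passes through `0`, so the ray from `0` through `g` leaves the disc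
for good at `g`. Here `w = (s / t) g` with `s / t ≥ 1`, written without division. -/
theorem eq_of_ray_eq {w g : ℂ} (hw : normSq w ≤ -2 * w.re) (hg : normSq g = -2 * g.re)
    (hg0 : g.re < 0) {s t : ℝ} (hs : 0 < s) (hst : t ≤ s) (h : t * w = s * g) (hwr : w.re < 0) :
    w = g := by
  have h1 : t * w.re = s * g.re := by simpa using congrArg re h
  have h2 : t * w.im = s * g.im := by simpa using congrArg im h
  rw [normSq_apply] at hw hg
  have ht : 0 < t := by
    by_contra hn
    nlinarith [mul_pos hs (neg_pos.2 hg0), mul_nonneg (not_lt.1 hn |> neg_nonneg.2) (neg_pos.2 hwr).le]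
  have h3 : t ^ 2 * (w.re * w.re + w.im * w.im) = s ^ 2 * (g.re * g.re + g.im * g.im) := by
    linear_combination (t * w.re + s * g.re) * h1 + (t * w.im + s * g.im) * h2
  have h4 : s ^ 2 * (-2 * g.re) ≤ t ^ 2 * (-2 * w.re) := by
    rw [← hg, ← h3]
    exact mul_le_mul_of_nonneg_left hw (sq_nonneg t)
  have h5 : s * (s * (-2 * g.re)) ≤ t * (s * (-2 * g.re)) := by
    have : t ^ 2 * (-2 * w.re) = t * (s * (-2 * g.re)) := by linear_combination (-2 * t) * h1
    nlinarith
  have h6 : s ≤ t := le_of_mul_le_mul_right h5 (mul_pos hs (by linarith))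
  have h7 : s = t := le_antisymm h6 hst
  subst h7
  exact mul_left_cancel₀ (by exact_mod_cast hs.ne') h

theorem isArc_rayImage {g : ℂ} (hg : g.re < 0) : IsArc (rayImage g) 0 (g - I)⁻¹ := by
  refine ⟨⟨⟨fun t : unitInterval => ((t : ℝ) : ℂ) / (g - (t : ℝ) * I), ?_⟩, by simp, by simp⟩, ?_, ?_⟩
  · exact Continuous.div (by fun_prop) (by fun_prop) fun t => ray_denominator_ne_zero hg t
  · intro s t hst
    have h1 : ((s : ℝ) : ℂ) / (g - (s : ℝ) * I) = ((t : ℝ) : ℂ) / (g - (t : ℝ) * I) := hst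
    rw [div_eq_div_iff (ray_denominator_ne_zero hg _) (ray_denominator_ne_zero hg _)] at h1
    have h2 : (((s : ℝ) : ℂ) - (t : ℝ)) * g = 0 := by linear_combination h1
    have hg0 : g ≠ 0 := fun h => by simp [h] at hg
    have h3 := (mul_eq_zero.1 h2).resolve_right hg0
    exact Subtype.ext (by exact_mod_cast sub_eq_zero.1 h3)
  · ext z
    simp [rayImage]

theorem re_of_mem_rayImage {g z : ℂ} (hg : g.re < 0) (hz : z ∈ rayImage g) : z.re < 0 ∨ z = 0 := by
  obtain ⟨t, ht, rfl⟩ := hz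
  rcases ht.1.eq_or_lt with h | h
  · right
    simp [← h]
  · left
    have h1 : (t : ℂ) ≠ 0 := by exact_mod_cast h.ne'
    have h2 : (t : ℂ) / (g - t * I) = (g / t - I)⁻¹ := by
      have := ray_denominator_ne_zero hg t
      rw [← one_div, div_eq_div_iff this]
      · field_simp
      · intro h'
        apply this
        field_simp at h'
        linear_combination h'
    simp only [h2]
    apply re_inv_sub_I_neg
    rw [div_ofReal_re]
    exact div_neg_of_neg_of_pos hg h

/-- A ray that reconnects an edge to `x` meets the image of the truncated drawing only in the foot
of that edge. -/
theorem eq_of_inv_mem_rayImage {w g : ℂ} (hw : normSq w ≤ -2 * w.re) (hg : normSq g = -2 * g.re)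
    (hg0 : g.re < 0) (h : (w - I)⁻¹ ∈ rayImage g) : w = g := by
  obtain ⟨t, ht, h⟩ := h
  have h1 := sub_I_ne_zero_of_normSq_le hw
  have h2 := ray_denominator_ne_zero hg0 t
  simp only at h
  rw [← one_div, div_eq_div_iff h2 h1] at h
  have h3 : (t : ℂ) * w = (1 : ℝ) * g := by
    push_cast
    linear_combination h
  have hw0 : w ≠ 0 := by
    rintro rfl
    have : g = 0 := by simpa using h3.symm
    simp [this] at hg0
  exact eq_of_ray_eq hw hg hg0 one_pos ht.2 h3 (re_neg_of_normSq_le hw hw0)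

/-- Rays from the origin with a common finite point have the same direction, hence the same foot;
the excluded point `z = 0` is the common end at infinity. -/
theorem eq_of_mem_rayImage {w g z : ℂ} (hw : normSq w = -2 * w.re) (hg : normSq g = -2 * g.re)
    (hw0 : w.re < 0) (hg0 : g.re < 0) (hz : z ≠ 0) (h : z ∈ rayImage w) (h' : z ∈ rayImage g) :
    w = g := by
  obtain ⟨t, ht, rfl⟩ := h
  obtain ⟨s, hs, h⟩ := h'
  have ht0 : 0 < t := ht.1.lt_of_ne fun h => hz (by simp [← h])
  have hs0 : 0 < s := hs.1.lt_of_ne fun h' => hz (by rw [← h]; simp [← h'])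
  simp only at h
  rw [div_eq_div_iff (ray_denominator_ne_zero hg0 s) (ray_denominator_ne_zero hw0 t)] at h
  have h1 : (s : ℂ) * w = t * g := by linear_combination h
  rcases le_total s t with hst | hst
  · exact eq_of_ray_eq hw.le hg hg0 ht0 hst h1 hw0
  · exact (eq_of_ray_eq hg.le hw hw0 hs0 hst h1.symm hg0).symm

theorem halfMap_ne_zero {o a z : ℂ} (ha : a ≠ 0) (h : ‖a‖ ≤ dist z o) : halfMap o a z ≠ 0 :=
  inv_ne_zero (sub_I_ne_zero_of_normSq_le (normSq_le_of_outside ha h))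

theorem eq_of_div_sub_one_eq {o a z z' : ℂ} (ha : a ≠ 0) (h : ‖a‖ ≤ dist z o)
    (h' : ‖a‖ ≤ dist z' o) (heq : a / (z - o) - 1 = a / (z' - o) - 1) : z = z' := by
  have h0 : 0 < ‖a‖ := norm_pos_iff.2 ha
  have h1 : z - o ≠ 0 := norm_pos_iff.1 (h0.trans_le (by rwa [Complex.dist_eq] at h))
  have h2 : z' - o ≠ 0 := norm_pos_iff.1 (h0.trans_le (by rwa [Complex.dist_eq] at h'))
  have h3 : a / (z - o) = a / (z' - o) := by linear_combination heq
  rw [div_eq_div_iff h1 h2] at h3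
  linear_combination -(mul_left_cancel₀ ha h3)

theorem halfMap_injOn {o a z z' : ℂ} (ha : a ≠ 0) (h : ‖a‖ ≤ dist z o)
    (h' : ‖a‖ ≤ dist z' o) (heq : halfMap o a z = halfMap o a z') : z = z' :=
  eq_of_div_sub_one_eq ha h h' (by linear_combination inv_injective heq)

theorem halfMap_continuousOn {o a : ℂ} (ha : a ≠ 0) :
    ContinuousOn (halfMap o a) {z | ‖a‖ ≤ dist z o} := by
  have h0 : 0 < ‖a‖ := norm_pos_iff.2 ha
  intro z hz
  have h1 : z - o ≠ 0 := norm_pos_iff.1 (h0.trans_le (by rwa [mem_ofPred_eq, Complex.dist_eq] at hz))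
  have h2 := sub_I_ne_zero_of_normSq_le (normSq_le_of_outside ha hz)
  refine ContinuousAt.continuousWithinAt ?_
  unfold halfMap
  refine ContinuousAt.inv₀ (ContinuousAt.sub (ContinuousAt.sub (ContinuousAt.div ?_ ?_ h1) ?_) ?_) h2
  all_goals fun_prop

theorem re_halfMap_neg {o a z : ℂ} (ha : a ≠ 0) (h : ‖a‖ ≤ dist z o) (hz : z ≠ o + a) :
    (halfMap o a z).re < 0 := by
  refine re_inv_sub_I_neg (re_neg_of_normSq_le (normSq_le_of_outside ha h) fun h' => hz ?_)
  refine eq_of_div_sub_one_eq ha h (by simp) ?_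
  rw [h', add_sub_cancel_left, div_self ha, sub_self]

theorem halfMap_add {o a : ℂ} (ha : a ≠ 0) : halfMap o a (o + a) = I := by
  simp [halfMap, div_self ha]

end HalfPlane

/-! ### Drawings in a half plane, and their sums at a vertex. -/

namespace Drawing

variable {V E F : Type*} {S T : Set V} {ends : E → Sym2 V} {ends' : F → Sym2 V}

open Classical in
/-- A drawing can be pushed into a half plane, a vertex `x` on its boundary excepted. -/
theorem exists_halfPlane_of_truncation (D : Drawing S ends) {x : V} (hx : x ∈ S)
    (t : Truncation D x) {a : ℂ} (har : ‖a‖ = t.r) (hfoot : ∀ e, x ∈ ends e → t.foot e ≠ D.pt x + a) :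
    ∃ D' : Drawing S ends, D'.pt x = 0 ∧
      (∀ v, v ≠ x → D'.pt v = halfMap (D.pt x) a (D.pt v)) ∧
      (∀ e, ∀ z ∈ D'.arc e, z.re < 0 ∨ z = 0) ∧
      ∀ e z, t.r ≤ dist z (D.pt x) → halfMap (D.pt x) a z ∈ D'.arc e → z ∈ D.arc e := by
  obtain ⟨r, foot, tail, hr, hpt, harc, htail, hsub, hdist, hout⟩ := t
  simp only at har hfoot ⊢
  subst har
  have ha : a ≠ 0 := norm_pos_iff.1 hr
  set o := D.pt x with ho
  -- The feet in the coordinate `w = a / (z - o) - 1`. An edge at `x` will run from `w = ∞`, which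
  -- the final inversion sends to `0`, along the ray to `g e`, and then along the image of its tail.
  let g : E → ℂ := fun e => a / (foot e - o) - 1
  have hg : ∀ e, x ∈ ends e → Complex.normSq (g e) = -2 * (g e).re := fun e he =>
    normSq_eq_of_dist_eq ha (hdist e he)
  have hg0 : ∀ e, x ∈ ends e → (g e).re < 0 := fun e he => by
    refine re_neg_of_normSq_le (hg e he).le fun h => hfoot e he ?_
    refine eq_of_div_sub_one_eq (o := o) ha (hdist e he).ge (by simp) ?_
    rw [add_sub_cancel_left, div_self ha, sub_self]
    exact h
  have htail_out : ∀ e, x ∈ ends e → ∀ z ∈ tail e, ‖a‖ ≤ dist z o := fun e he z hz => by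
    by_contra h
    rw [hout e he z hz (not_le.1 h).le, hdist e he] at h
    exact h le_rfl
  let arc : E → Set ℂ := fun e =>
    if x ∈ ends e then rayImage (g e) ∪ halfMap o a '' tail e else halfMap o a '' D.arc e
  have harc1 : ∀ e, x ∈ ends e → arc e = rayImage (g e) ∪ halfMap o a '' tail e :=
    fun e he => if_pos he
  have harc2 : ∀ e, x ∉ ends e → arc e = halfMap o a '' D.arc e := fun e he => if_neg he
  have hfoot_mem : ∀ e, x ∈ ends e → foot e ∈ tail e := by
    rintro e ⟨y, hy⟩
    exact (htail e y hy).left_mem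
  -- points of a new arc that come from the truncated old drawing
  have back : ∀ e z, ‖a‖ ≤ dist z o → halfMap o a z ∈ arc e → z ∈ D.arc e := by
    intro e z hz h
    by_cases he : x ∈ ends e
    · rw [harc1 e he] at h
      rcases h with h | ⟨z', hz', h⟩
      · have h1 := eq_of_inv_mem_rayImage (normSq_le_of_outside ha hz) (hg e he) (hg0 e he) h
        rw [eq_of_div_sub_one_eq ha hz (hdist e he).ge h1]
        exact hsub e he (hfoot_mem e he)
      · rw [← halfMap_injOn ha (htail_out e he z' hz') hz h]
        exact hsub e he hz'
    · rw [harc2 e he] at h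
      obtain ⟨z', hz', h⟩ := h
      rwa [← halfMap_injOn ha (harc e he z' hz').le hz h]
  -- A new arc consists of images of old points outside the disc and possibly a ray. `back` handles
  -- the former, so the only new kind of intersection is between two rays.
  have split : ∀ e, ∀ p ∈ arc e, (∃ z ∈ D.arc e, ‖a‖ ≤ dist z o ∧ z ≠ o + a ∧ halfMap o a z = p) ∨
      (x ∈ ends e ∧ p ∈ rayImage (g e)) := by
    intro e p hp
    by_cases he : x ∈ ends e
    · rw [harc1 e he] at hp
      rcases hp with h | ⟨z', hz', h⟩
      · exact Or.inr ⟨he, h⟩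
      · refine Or.inl ⟨z', hsub e he hz', htail_out e he z' hz', ?_, h⟩
        rintro rfl
        exact hfoot e he (hout e he _ hz' (by simp)).symm
    · rw [harc2 e he] at hp
      obtain ⟨z', hz', h⟩ := hp
      refine Or.inl ⟨z', hz', (harc e he z' hz').le, ?_, h⟩
      rintro rfl
      simpa using harc e he _ hz'
  let pt : V → ℂ := fun v => if v = x then 0 else halfMap o a (D.pt v)
  have hptx : pt x = 0 := if_pos rfl
  have hptv : ∀ v, v ≠ x → pt v = halfMap o a (D.pt v) := fun v hv => if_neg hv
  have hzero : ∀ e, (0 : ℂ) ∈ arc e → x ∈ ends e := by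
    intro e h
    rcases split e 0 h with ⟨z, -, hz, -, h0⟩ | h
    · exact absurd h0 (halfMap_ne_zero ha hz)
    · exact h.1
  refine ⟨⟨pt, arc, D.ends_mem, ?_, ?_, ?_, ?_⟩, hptx, hptv, ?_, back⟩
  · intro u hu v hv huv
    by_cases h1 : u = x <;> by_cases h2 : v = x
    · rw [h1, h2]
    · rw [h1, hptx, hptv v h2] at huv
      exact absurd huv.symm (halfMap_ne_zero ha (hpt v hv h2).le)
    · rw [h2, hptx, hptv u h1] at huv
      exact absurd huv (halfMap_ne_zero ha (hpt u hu h1).le)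
    · rw [hptv u h1, hptv v h2] at huv
      exact D.injOn hu hv (halfMap_injOn ha (hpt u hu h1).le (hpt v hv h2).le huv)
  · have key : ∀ e v, ends e = s(x, v) → IsArc (arc e) (pt x) (pt v) := by
      intro e v he
      have hxe : x ∈ ends e := by simp [he]
      have hvx : v ≠ x := fun h => (D.isArc e x v he).ne (by rw [h])
      rw [harc1 e hxe, hptx, hptv v hvx]
      refine (isArc_rayImage (hg0 e hxe)).trans ((htail e v he).image (f := halfMap o a)
        ((halfMap_continuousOn ha).mono (htail_out e hxe)) ?_) ?_
      · exact fun z hz z' hz' h => halfMap_injOn ha (htail_out e hxe z hz) (htail_out e hxe z' hz') h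
      · rintro _ h ⟨z, hz, rfl⟩
        have h1 := eq_of_inv_mem_rayImage (normSq_le_of_outside ha (htail_out e hxe z hz))
          (hg e hxe) (hg0 e hxe) h
        unfold halfMap
        rw [h1]
    intro e u v he
    by_cases h1 : u = x
    · subst h1
      exact key e v he
    by_cases h2 : v = x
    · subst h2
      exact (key e u (by rw [he, Sym2.eq_swap])).symm
    have hxe : x ∉ ends e := by
      rw [he, Sym2.mem_iff]
      rintro (h | h)
      · exact h1 h.symm
      · exact h2 h.symm
    rw [harc2 e hxe, hptv u h1, hptv v h2]
    exact (D.isArc e u v he).image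
      ((halfMap_continuousOn ha).mono fun z hz => (harc e hxe z hz).le)
      fun z hz z' hz' h => halfMap_injOn ha (harc e hxe z hz).le (harc e hxe z' hz').le h
  · intro e w hw h
    by_cases hwx : w = x
    · subst hwx
      rw [hptx] at h
      exact hzero e h
    · rw [hptv w hwx] at h
      exact D.mem_ends e w hw (back e _ (hpt w hw hwx).le h)
  · have key : ∀ e f, e ≠ f → ∀ z ∈ D.arc e, ‖a‖ ≤ dist z o → halfMap o a z ∈ arc f →
        ∃ w, w ∈ ends e ∧ w ∈ ends f ∧ halfMap o a z = pt w := by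
      intro e f hef z hz hzo h
      obtain ⟨w, h1, h2, rfl⟩ := D.inter e f hef z hz (back f z hzo h)
      refine ⟨w, h1, h2, (hptv w ?_).symm⟩
      rintro rfl
      rw [← ho, dist_self] at hzo
      linarith
    intro e f hef p he hf
    rcases split e p he with ⟨z, hz, hzo, -, rfl⟩ | ⟨hxe, hpe⟩
    · exact key e f hef z hz hzo hf
    rcases split f p hf with ⟨z, hz, hzo, -, rfl⟩ | ⟨hxf, hpf⟩
    · obtain ⟨w, h1, h2, h3⟩ := key f e hef.symm z hz hzo he
      exact ⟨w, h2, h1, h3⟩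
    by_cases hp : p = 0
    · exact ⟨x, hxe, hxf, by rw [hp, hptx]⟩
    · exfalso
      -- Rays meeting away from `0` have equal feet. The two old arcs then meet there, so the foot
      -- is a vertex at distance `r` from `x`, which the choice of `r` excludes.
      have h1 := eq_of_mem_rayImage (hg e hxe) (hg f hxf) (hg0 e hxe) (hg0 f hxf) hp hpe hpf
      have h2 := eq_of_div_sub_one_eq ha (hdist e hxe).ge (hdist f hxf).ge h1
      obtain ⟨w, h3, h4, h5⟩ := D.inter e f hef (foot e) (hsub e hxe (hfoot_mem e hxe))
        (h2 ▸ hsub f hxf (hfoot_mem f hxf))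
      have h6 := hdist e hxe
      by_cases hwx : w = x
      · rw [h5, hwx, ← ho, dist_self] at h6
        linarith
      · have := hpt w (D.ends_mem e w h3) hwx
        rw [← h5] at this
        linarith
  · intro e p hp
    rcases split e p hp with ⟨z, hz, hzo, hza, rfl⟩ | ⟨hxe, hpe⟩
    · exact Or.inl (re_halfMap_neg ha hzo hza)
    · exact re_of_mem_rayImage (hg0 e hxe) hpe

variable [Finite V] [Finite E] [Finite F]

/-- The circle is infinite and there are finitely many feet, so some point `o + a` of the circle is
not a foot. -/
theorem exists_halfPlane (D : Drawing S ends) {x : V} (hx : x ∈ S) :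
    ∃ D' : Drawing S ends, D'.pt x = 0 ∧ (∀ v ∈ S, v ≠ x → (D'.pt v).re < 0) ∧
      ∀ e, ∀ z ∈ D'.arc e, z.re < 0 ∨ z = 0 := by
  obtain ⟨t⟩ := D.exists_truncation hx
  have hinf : (Metric.sphere (D.pt x) t.r).Infinite := by
    refine IsPreconnected.infinite_of_nontrivial
      (isPreconnected_sphere (by simp [Complex.rank_real_complex]) _ _) ?_
    refine ⟨D.pt x + t.r, by simp [t.r_pos.le], D.pt x - t.r, by simp [t.r_pos.le], fun h => ?_⟩
    have := congrArg Complex.re h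
    simp at this
    linarith [t.r_pos]
  obtain ⟨c, hc, hcf⟩ := hinf.exists_notMem_finite (finite_range t.foot)
  have har : ‖c - D.pt x‖ = t.r := by rwa [mem_sphere_iff_norm] at hc
  have ha0 : c - D.pt x ≠ 0 := norm_pos_iff.1 (har ▸ t.r_pos)
  obtain ⟨D', h1, h2, h3, -⟩ := D.exists_halfPlane_of_truncation hx t har fun e _ h =>
    hcf ⟨e, by rw [h]; ring⟩
  refine ⟨D', h1, fun v hv hvx => ?_, h3⟩
  have hd := t.lt_dist_pt v hv hvx
  rw [h2 v hvx]
  refine re_halfMap_neg ha0 (har ▸ hd.le) fun h => ?_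
  rw [h, dist_self_add_left, har] at hd
  exact lt_irrefl _ hd

/-- The foot of the distinguished edge serves as `o + a`, so the image `Z` of its tail starts at
`I`. No other edge has this foot, since distinct arcs meet only in vertices and no vertex lies on
the circle. -/
theorem exists_halfPlane_of_edge {ends : Option E → Sym2 V} (D : Drawing S ends) {x u : V}
    (he : ends none = s(x, u)) :
    ∃ (D' : Drawing S (fun e => ends (some e))) (Z : Set ℂ), D'.pt x = 0 ∧
      (∀ v ∈ S, v ≠ x → (D'.pt v).re < 0) ∧ (∀ e, ∀ z ∈ D'.arc e, z.re < 0 ∨ z = 0) ∧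
      IsArc Z Complex.I (D'.pt u) ∧ (∀ z ∈ Z, z.re < 0 ∨ z = Complex.I) ∧
      (∀ w ∈ S, D'.pt w ∈ Z → w = u) ∧ ∀ e, ∀ z ∈ D'.arc e, z ∈ Z → ∃ w ∈ ends (some e), z = D'.pt w := by
  have hx : x ∈ S := D.ends_mem none x (by simp [he])
  have hu : u ∈ S := D.ends_mem none u (by simp [he])
  have hxe : x ∈ ends none := by simp [he]
  have hux : u ≠ x := fun h => (D.isArc none x u he).ne (by rw [h])
  obtain ⟨t⟩ := D.exists_truncation hx
  let D₀ : Drawing S (fun e => ends (some e)) := D.comap some (Option.some_injective E)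
    (fun _ => rfl) subset_rfl fun e => D.ends_mem (some e)
  let t₀ : Truncation D₀ x := ⟨t.r, fun e => t.foot (some e), fun e => t.tail (some e), t.r_pos,
    t.lt_dist_pt, fun e => t.lt_dist_arc (some e), fun e => t.isArc_tail (some e),
    fun e => t.tail_subset (some e), fun e => t.dist_foot (some e), fun e => t.tail_outside (some e)⟩
  have hfoot : t.foot none ∈ t.tail none := (t.isArc_tail none u he).left_mem
  obtain ⟨a, ha⟩ : ∃ a, t.foot none = D.pt x + a := ⟨t.foot none - D.pt x, by ring⟩
  have har : ‖a‖ = t.r := by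
    rw [← t.dist_foot none hxe, ha, dist_self_add_left]
  have ha0 : a ≠ 0 := norm_pos_iff.1 (har ▸ t.r_pos)
  have hvertex : ∀ w ∈ S, dist (D.pt w) (D.pt x) ≠ t.r := by
    intro w hw h
    by_cases hwx : w = x
    · rw [hwx, dist_self] at h
      exact t.r_pos.ne h
    · exact (t.lt_dist_pt w hw hwx).ne' h
  obtain ⟨D', h1, h2, h3, h4⟩ := D₀.exists_halfPlane_of_truncation hx t₀ (a := a) har (by
    intro e hxe' h
    have h5 : t.foot (some e) = t.foot none := h.trans ha.symm
    obtain ⟨y, hy⟩ := hxe'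
    obtain ⟨w, hw1, -, hw⟩ := D.inter none (some e) (by simp) (t.foot none)
      (t.tail_subset none hxe hfoot)
      (h5 ▸ t.tail_subset (some e) ⟨y, hy⟩ (t.isArc_tail (some e) y hy).left_mem)
    refine hvertex w (D.ends_mem none w hw1) ?_
    rw [← hw]
    exact t.dist_foot none hxe)
  have hout : ∀ z ∈ t.tail none, t.r ≤ dist z (D.pt x) := fun z hz => by
    by_contra h
    rw [t.tail_outside none hxe z hz (not_le.1 h).le, t.dist_foot none hxe] at h
    exact h le_rfl
  have hback : ∀ z ∈ t.tail none, ∀ w ∈ ends none, z = D.pt w → w = u := by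
    intro z hz w hw h
    rw [he] at hw
    refine (Sym2.mem_iff.1 hw).resolve_left fun hwx => ?_
    have := hout z hz
    rw [h, hwx, dist_self] at this
    linarith [t.r_pos]
  refine ⟨D', halfMap (D.pt x) a '' t.tail none, h1, fun v hv hvx => ?_, h3, ?_, ?_, ?_, ?_⟩
  · have hd := t.lt_dist_pt v hv hvx
    rw [h2 v hvx]
    refine re_halfMap_neg ha0 (har ▸ hd.le) fun h => ?_
    change D.pt v = D.pt x + a at h
    rw [h, dist_self_add_left, har] at hd
    exact lt_irrefl _ hd
  · rw [h2 u hux, ← halfMap_add (o := D.pt x) ha0, ← ha]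
    refine (t.isArc_tail none u he).image ((halfMap_continuousOn ha0).mono ?_) ?_
    · intro z hz
      exact har ▸ hout z hz
    · intro z hz z' hz'
      exact halfMap_injOn ha0 (har ▸ hout z hz) (har ▸ hout z' hz')
  · rintro _ ⟨z, hz, rfl⟩
    by_cases h : z = D.pt x + a
    · right
      rw [h, halfMap_add ha0]
    · left
      exact re_halfMap_neg ha0 (har ▸ hout z hz) h
  · rintro w hw ⟨z, hz, h⟩
    by_cases hwx : w = x
    · rw [hwx, h1] at h
      exact absurd h (halfMap_ne_zero ha0 (har ▸ hout z hz))
    · rw [h2 w hwx] at h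
      have hzw : z = D.pt w :=
        halfMap_injOn ha0 (har ▸ hout z hz) (har ▸ (t.lt_dist_pt w hw hwx).le) h
      exact hback z hz w (D.mem_ends none w hw (hzw ▸ t.tail_subset none hxe hz)) hzw
  · rintro e _ hze ⟨z, hz, rfl⟩
    have h5 : z ∈ D.arc (some e) := h4 e z (hout z hz) hze
    obtain ⟨w, hw1, hw2, hw⟩ := D.inter none (some e) (by simp) z (t.tail_subset none hxe hz) h5
    obtain rfl := hback z hz w hw1 hw
    refine ⟨w, hw2, ?_⟩
    rw [h2 w hux, hw]
    rfl

/-- The reflection in the imaginary axis. -/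
noncomputable def reflection : ℂ ≃ₜ ℂ :=
  Complex.conjCLE.toHomeomorph.trans (Homeomorph.neg ℂ)

theorem reflection_re (z : ℂ) : (reflection z).re = -z.re := by simp [reflection]

theorem reflection_zero : reflection 0 = 0 := by simp [reflection]

theorem reflection_I : reflection Complex.I = Complex.I := by simp [reflection]

/-- Both drawings are pushed into the left half plane with `x` at `0`, and one is reflected to the
right. -/
theorem exists_oneSum (D : Drawing S ends) (D' : Drawing T ends') {x : V} (hST : S ∩ T = {x}) :
    Nonempty (Drawing (S ∪ T) (Sum.elim ends ends')) := by
  obtain ⟨D₁, h1, h2, h3⟩ := D.exists_halfPlane (hST.ge rfl).1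
  obtain ⟨D₂, k1, k2, k3⟩ := D'.exists_halfPlane (hST.ge rfl).2
  refine ⟨D₁.glue (D₂.map reflection) hST h1 (by simp [map, k1, reflection_zero]) h2 ?_ h3 ?_⟩
  · intro v hv hvx
    simpa [map, reflection_re] using k2 v hv hvx
  · rintro e _ ⟨z, hz, rfl⟩
    refine (k3 e z hz).imp (fun h => ?_) (fun h => ?_)
    · simpa [reflection_re] using h
    · rw [h, reflection_zero]

/-- The remainders `Z₁` and `Z₂` of the two distinguished edges meet exactly in `I`, so their union
is an arc from `u` to `v`. Neither can meet the opposite drawing, whose closest approach to the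
imaginary axis is at `0 ≠ I`. -/
theorem exists_twoSum {ends : Option E → Sym2 V} {ends' : Option F → Sym2 V}
    (D : Drawing S ends) (D' : Drawing T ends') {x u v : V} (hST : S ∩ T = {x})
    (hu : ends none = s(x, u)) (hv : ends' none = s(x, v)) :
    Nonempty (Drawing (S ∪ T) (fun o : Option (E ⊕ F) => o.elim s(u, v)
      (Sum.elim (fun e => ends (some e)) (fun e => ends' (some e))))) := by
  have huS : u ∈ S := D.ends_mem none u (by simp [hu])
  have hvT : v ∈ T := D'.ends_mem none v (by simp [hv])
  have hux : u ≠ x := fun h => (D.isArc none x u hu).ne (by rw [h])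
  have hvx : v ≠ x := fun h => (D'.isArc none x v hv).ne (by rw [h])
  obtain ⟨D₁, Z₁, h1, h2, h3, h4, h5, h6, h7⟩ := D.exists_halfPlane_of_edge hu
  obtain ⟨D₂', Z₂', k1', k2', k3', k4', k5', k6', k7'⟩ := D'.exists_halfPlane_of_edge hv
  let D₂ := D₂'.map reflection
  let Z₂ := reflection '' Z₂'
  have k1 : D₂.pt x = 0 := by simp [D₂, map, k1', reflection_zero]
  have k2 : ∀ v ∈ T, v ≠ x → 0 < (D₂.pt v).re := by
    intro v hv hvx
    simpa [D₂, map, reflection_re] using k2' v hv hvx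
  have k3 : ∀ e, ∀ z ∈ D₂.arc e, 0 < z.re ∨ z = 0 := by
    rintro e _ ⟨z, hz, rfl⟩
    refine (k3' e z hz).imp (fun h => ?_) (fun h => ?_)
    · simpa [reflection_re] using h
    · rw [h, reflection_zero]
  have k4 : IsArc Z₂ Complex.I (D₂.pt v) := by
    have := k4'.image (f := reflection) reflection.continuous.continuousOn reflection.injective.injOn
    rwa [reflection_I] at this
  have k5 : ∀ z ∈ Z₂, 0 < z.re ∨ z = Complex.I := by
    rintro _ ⟨z, hz, rfl⟩
    refine (k5' z hz).imp (fun h => ?_) (fun h => ?_)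
    · simpa [reflection_re] using h
    · rw [h, reflection_I]
  have k6 : ∀ w ∈ T, D₂.pt w ∈ Z₂ → w = v := by
    rintro w hw ⟨z, hz, h⟩
    exact k6' w hw (reflection.injective h ▸ hz)
  have k7 : ∀ e, ∀ z ∈ D₂.arc e, z ∈ Z₂ → ∃ w ∈ ends' (some e), z = D₂.pt w := by
    rintro e _ ⟨z, hz, rfl⟩ ⟨z', hz', h⟩
    obtain rfl := reflection.injective h
    obtain ⟨w, hw, rfl⟩ := k7' e z' hz hz'
    exact ⟨w, hw, rfl⟩
  let D₃ := D₁.glue D₂ hST h1 k1 h2 k2 h3 k3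
  have hS : ∀ w ∈ S, D₃.pt w = D₁.pt w := fun w hw => if_pos hw
  have hT : ∀ w ∈ T, D₃.pt w = D₂.pt w := fun w hw => by
    by_cases h : w ∈ S
    · obtain rfl : w = x := hST.le ⟨h, hw⟩
      rw [hS w h, h1, k1]
    · exact if_neg h
  have hre : ∀ w ∈ S, (D₁.pt w).re < 0 ∨ D₁.pt w = 0 := fun w hw => by
    by_cases h : w = x
    · exact Or.inr (by rw [h, h1])
    · exact Or.inl (h2 w hw h)
  have kre : ∀ w ∈ T, 0 < (D₂.pt w).re ∨ D₂.pt w = 0 := fun w hw => by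
    by_cases h : w = x
    · exact Or.inr (by rw [h, k1])
    · exact Or.inl (k2 w hw h)
  have cross : ∀ z : ℂ, (z.re < 0 ∨ z = 0) → (0 < z.re ∨ z = Complex.I) → False := by
    rintro z (h | h) (h' | h')
    · linarith
    · simp [h'] at h
    · simp [h] at h'
    · exact Complex.I_ne_zero (h'.symm.trans h)
  have cross' : ∀ z : ℂ, (0 < z.re ∨ z = 0) → (z.re < 0 ∨ z = Complex.I) → False := by
    rintro z (h | h) (h' | h')
    · linarith
    · simp [h'] at h
    · simp [h] at h'
    · exact Complex.I_ne_zero (h'.symm.trans h)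
  refine ⟨D₃.addEdge (Or.inl huS) (Or.inr hvT) (A := Z₁ ∪ Z₂) ?_ ?_ ?_⟩
  · rw [hS u huS, hT v hvT]
    refine h4.symm.trans k4 ?_
    intro z hz hz'
    rcases h5 z hz with h | h
    · rcases k5 z hz' with h' | h'
      · linarith
      · exact h'
    · exact h
  · rintro w (hw | hw) (hz | hz)
    · rw [hS w hw] at hz
      exact Or.inl (h6 w hw hz)
    · rw [hS w hw] at hz
      exact (cross _ (hre w hw) (k5 _ hz)).elim
    · rw [hT w hw] at hz
      exact (cross' _ (kre w hw) (h5 _ hz)).elim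
    · rw [hT w hw] at hz
      exact Or.inr (k6 w hw hz)
  · rintro (e | e) z he (hz | hz)
    · obtain ⟨w, hw, h⟩ := h7 e z he hz
      exact ⟨w, hw, by rw [hS w (D₁.ends_mem e w hw), h]⟩
    · exact (cross _ (h3 e z he) (k5 _ hz)).elim
    · exact (cross' _ (k3 e z he) (h5 _ hz)).elim
    · obtain ⟨w, hw, h⟩ := k7 e z he hz
      exact ⟨w, hw, by rw [hT w (D₂.ends_mem e w hw), h]⟩

end Drawing

/-! ### Homeomorphisms of the plane that move one point to another. -/

theorem exists_homeomorph_of_mem_ball {p q : ℂ} {ε : ℝ} (h : q ∈ Metric.ball p ε) :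
    ∃ f : ℂ ≃ₜ ℂ, (∀ z, z ∉ Metric.ball p ε → f z = z) ∧ f p = q := by
  have hd : dist q p < ε := h
  have hε : 0 < ε := dist_nonneg.trans_lt hd
  -- A translation by `q - p` damped linearly to zero at the boundary of the ball. `F - id` has
  -- Lipschitz constant `dist q p / ε < 1`, so `F` is a homeomorphism.
  let F : ℂ → ℂ := fun z => z + (max 0 (1 - dist z p / ε) : ℝ) * (q - p)
  have hF : ApproximatesLinearOn F ((ContinuousLinearEquiv.refl ℝ ℂ : ℂ ≃L[ℝ] ℂ) : ℂ →L[ℝ] ℂ) univ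
      (nndist q p / ⟨ε, hε.le⟩) := by
    intro z _ w _
    have h1 : F z - F w - (z - w) =
        ((max 0 (1 - dist z p / ε) - max 0 (1 - dist w p / ε) : ℝ) : ℂ) * (q - p) := by
      simp only [F]
      push_cast
      ring
    have h2 : |max 0 (1 - dist z p / ε) - max 0 (1 - dist w p / ε)| ≤ ‖z - w‖ / ε := by
      refine (abs_max_sub_max_le_max _ _ _ _).trans (max_le (by simp; positivity) ?_)
      have h3 : (1 - dist z p / ε) - (1 - dist w p / ε) = (dist w p - dist z p) / ε := by ring
      rw [h3, abs_div, abs_of_pos hε, ← Complex.dist_eq, dist_comm z w]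
      gcongr
      exact abs_dist_sub_le w z p
    change ‖F z - F w - (z - w)‖ ≤ dist q p / ε * ‖z - w‖
    rw [h1, norm_mul, Complex.norm_real, Real.norm_eq_abs, ← Complex.dist_eq q p]
    calc _ ≤ ‖z - w‖ / ε * dist q p := by gcongr
      _ = _ := by ring
  refine ⟨hF.toHomeomorph F (Or.inr ?_), ?_, ?_⟩
  · have h1 : dist q p / ε < 1 := (div_lt_one hε).2 hd
    have h2 : ‖((ContinuousLinearEquiv.refl ℝ ℂ).symm : ℂ →L[ℝ] ℂ)‖₊ = 1 := by
      rw [ContinuousLinearEquiv.refl_symm, ContinuousLinearEquiv.coe_refl]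
      exact ContinuousLinearMap.nnnorm_id
    rw [h2, inv_one]
    exact h1
  · intro z hz
    change F z = z
    have : 1 ≤ dist z p / ε := by
      rw [le_div_iff₀ hε, one_mul]
      exact not_lt.1 hz
    simp [F, max_eq_left (sub_nonpos.2 this)]
  · change F p = q
    simp [F]

/-- Two points in a connected part of an open set `U` are exchanged by a homeomorphism of the plane
that is the identity outside of `U`. -/
theorem exists_homeomorph_of_isPreconnected {U C : Set ℂ} (hU : IsOpen U) (hC : IsPreconnected C)
    (hCU : C ⊆ U) {p q : ℂ} (hp : p ∈ C) (hq : q ∈ C) :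
    ∃ f : ℂ ≃ₜ ℂ, (∀ z, z ∉ U → f z = z) ∧ f p = q := by
  refine hC.induction₂ (fun p q => ∃ f : ℂ ≃ₜ ℂ, (∀ z, z ∉ U → f z = z) ∧ f p = q) ?_ ?_ ?_ hp hq
  · intro p hp
    obtain ⟨ε, hε, hb⟩ := Metric.isOpen_iff.1 hU p (hCU hp)
    filter_upwards [mem_nhdsWithin_of_mem_nhds (Metric.ball_mem_nhds p hε)] with q hq
    obtain ⟨f, hf, hfp⟩ := exists_homeomorph_of_mem_ball hq
    exact ⟨f, fun z hz => hf z fun h => hz (hb h), hfp⟩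
  · rintro p q s - - - ⟨f, hf, rfl⟩ ⟨g, hg, rfl⟩
    exact ⟨f.trans g, fun z hz => by simp [hf z hz, hg z hz], rfl⟩
  · rintro p q - - ⟨f, hf, rfl⟩
    exact ⟨f.symm, fun z hz => (Homeomorph.symm_apply_eq f).2 (hf z hz).symm, by simp⟩

/-! ### Cones and petals at an end of an edge. -/

/-- The coordinate on the plane in which `u` is `0` and `f` is `1`. -/
noncomputable def coord (u f z : ℂ) : ℂ := (z - u) / (f - u)

section Coord

variable {u f z : ℂ}

theorem continuous_coord : Continuous (coord u f) := by
  unfold coord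
  fun_prop

theorem dist_eq_norm_coord (h : f ≠ u) : dist z u = ‖coord u f z‖ * dist f u := by
  have h0 : f - u ≠ 0 := sub_ne_zero.2 h
  rw [Complex.dist_eq, Complex.dist_eq, coord, ← norm_mul, div_mul_cancel₀ _ h0]

theorem coord_lineMap (d : ℂ) (s : ℝ) : coord u f (u + s * (d - u)) = s * coord u f d := by
  unfold coord
  ring

theorem mem_segment_iff {p q z : ℂ} : z ∈ segment ℝ p q ↔ ∃ s : ℝ, 0 ≤ s ∧ s ≤ 1 ∧ z = p + s * (q - p) := by
  rw [segment_eq_image']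
  constructor
  · rintro ⟨s, hs, rfl⟩
    exact ⟨s, hs.1, hs.2, by simp⟩
  · rintro ⟨s, h0, h1, rfl⟩
    exact ⟨s, ⟨h0, h1⟩, by simp⟩

/-- Finitely many other radii avoid a thin cone around the radius from `u` to `f`. -/
theorem eventually_cone_free {F : Set ℂ} (hF : F.Finite) (hf : f ≠ u) (hfF : f ∉ F)
    (hd : ∀ d ∈ F, dist d u = dist f u) :
    ∀ᶠ ε : ℝ in 𝓝[>] 0, ∀ d ∈ F, ∀ z ∈ segment ℝ u d, 0 < (coord u f z).re →
      ¬ |(coord u f z).im| ≤ ε * (coord u f z).re := by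
  refine (eventually_all_finite hF).2 fun d hdF => ?_
  have hnorm : ‖coord u f d‖ = 1 := by
    have h1 := dist_eq_norm_coord (z := d) hf
    rw [hd d hdF] at h1
    exact (mul_right_cancel₀ (dist_pos.2 hf).ne' ((one_mul _).trans h1)).symm
  have key : ∀ z ∈ segment ℝ u d, 0 < (coord u f z).re →
      ∃ s : ℝ, 0 < s ∧ (coord u f z).re = s * (coord u f d).re ∧
        (coord u f z).im = s * (coord u f d).im ∧ 0 < (coord u f d).re := by
    intro z hz hre
    obtain ⟨s, hs, -, rfl⟩ := mem_segment_iff.1 hz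
    rw [coord_lineMap, Complex.re_ofReal_mul] at hre
    have hs0 : 0 < s := hs.lt_of_ne (by rintro rfl; simp at hre)
    rw [coord_lineMap, Complex.re_ofReal_mul, Complex.im_ofReal_mul]
    exact ⟨s, hs0, rfl, rfl, (pos_iff_pos_of_mul_pos hre).1 hs0⟩
  by_cases hpos : 0 < (coord u f d).re
  -- `coord u f d` has modulus `1`; with positive real part and zero imaginary part it would be `1`,
  -- forcing `d = f`. So `|im| / re` is a positive bound for admissible `ε`.
  · have him : (coord u f d).im ≠ 0 := by
      intro h0
      have h1 : (coord u f d).re ^ 2 = 1 := by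
        have h2 := Complex.sq_norm (coord u f d)
        rw [hnorm, Complex.normSq_apply, h0] at h2
        linarith
      have h2 : (coord u f d).re = 1 := by nlinarith
      have h3 : coord u f d = 1 := Complex.ext h2 h0
      rw [coord, div_eq_one_iff_eq (sub_ne_zero.2 hf)] at h3
      exact hfF (sub_left_inj.1 h3 ▸ hdF)
    filter_upwards [Ioo_mem_nhdsGT (div_pos (abs_pos.2 him) hpos)] with ε hε z hz hre hle
    obtain ⟨s, hs, h1, h2, -⟩ := key z hz hre
    rw [h1, h2, abs_mul, abs_of_pos hs] at hle
    have h3 := (lt_div_iff₀ hpos).1 hε.2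
    nlinarith
  · refine Eventually.of_forall fun ε z hz hre => ?_
    obtain ⟨s, -, -, -, h⟩ := key z hz hre
    exact absurd h hpos

end Coord

/-- A closed region with a corner at `u` around the middle of the segment from `u` to `f`. -/
def petal (u f : ℂ) (ε : ℝ) : Set ℂ :=
  {z | |(coord u f z).im| ≤ ε * ((coord u f z).re * (9 / 10 - (coord u f z).re))}

/-- The interior of the petal. -/
def openPetal (u f : ℂ) (ε : ℝ) : Set ℂ :=
  {z | |(coord u f z).im| < ε * ((coord u f z).re * (9 / 10 - (coord u f z).re))}

section Petal

variable {u f z t : ℂ} {ε : ℝ}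

theorem isClosed_petal : IsClosed (petal u f ε) := by
  have := continuous_coord (u := u) (f := f)
  exact isClosed_le (by fun_prop) (by fun_prop)

theorem isOpen_openPetal : IsOpen (openPetal u f ε) := by
  have := continuous_coord (u := u) (f := f)
  exact isOpen_lt (by fun_prop) (by fun_prop)

theorem openPetal_subset : openPetal u f ε ⊆ petal u f ε := fun z hz =>
  show |(coord u f z).im| ≤ _ from le_of_lt hz

theorem re_nonneg_of_mem_petal (hε : 0 < ε) (hz : z ∈ petal u f ε) :
    0 ≤ (coord u f z).re ∧ (coord u f z).re ≤ 9 / 10 := by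
  have h1 : 0 ≤ (coord u f z).re * (9 / 10 - (coord u f z).re) :=
    nonneg_of_mul_nonneg_right ((abs_nonneg _).trans hz) hε
  constructor <;> nlinarith

theorem eq_of_coord_eq_zero (hf : f ≠ u) (h : coord u f z = 0) : z = u := by
  rw [coord, div_eq_zero_iff] at h
  exact sub_eq_zero.1 (h.resolve_right (sub_ne_zero.2 hf))

theorem re_pos_of_mem_petal (hf : f ≠ u) (hε : 0 < ε) (hz : z ∈ petal u f ε) (hzu : z ≠ u) :
    0 < (coord u f z).re := by
  refine (re_nonneg_of_mem_petal hε hz).1.lt_of_ne fun h => hzu (eq_of_coord_eq_zero hf ?_)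
  have h1 : |(coord u f z).im| ≤ ε * ((coord u f z).re * (9 / 10 - (coord u f z).re)) := hz
  rw [← h] at h1
  exact Complex.ext h.symm (abs_nonpos_iff.1 (by simpa using h1))

theorem abs_im_le_of_mem_petal (hε : 0 < ε) (hz : z ∈ petal u f ε) :
    |(coord u f z).im| ≤ ε * (coord u f z).re := by
  obtain ⟨h0, h1⟩ := re_nonneg_of_mem_petal hε hz
  refine (show |(coord u f z).im| ≤ _ from hz).trans ?_
  gcongr
  nlinarith

/-- The constant `9 / 10` leaves room: `re ≤ 9 / 10` and `|im| ≤ 1 / 8` keep the modulus of the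
coordinate below `1`, while the midpoint `1 / 2` is still interior. -/
theorem dist_le_of_mem_petal (hf : f ≠ u) (hε : 0 < ε) (hε' : ε ≤ 1 / 2) (hz : z ∈ petal u f ε) :
    dist z u ≤ dist f u := by
  obtain ⟨h0, h1⟩ := re_nonneg_of_mem_petal hε hz
  rw [dist_eq_norm_coord hf]
  refine mul_le_of_le_one_left dist_nonneg ?_
  have h2 : |(coord u f z).im| ≤ ε * ((coord u f z).re * (9 / 10 - (coord u f z).re)) := hz
  have h3 : (coord u f z).re * (9 / 10 - (coord u f z).re) ≤ 1 / 4 := by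
    nlinarith [sq_nonneg ((coord u f z).re - 9 / 20)]
  have h4 : |(coord u f z).im| ≤ 1 / 8 := by nlinarith
  have h5 := Complex.sq_norm (coord u f z)
  rw [Complex.normSq_apply] at h5
  obtain ⟨h6, h7⟩ := abs_le.1 h4
  have h8 : ‖coord u f z‖ ^ 2 ≤ 1 := by nlinarith
  exact (sq_le_one_iff₀ (norm_nonneg _)).1 h8

theorem vertex_mem_petal : u ∈ petal u f ε := by simp [petal, coord]

/-- The petal is strictly star-shaped at `u`: scaling by `s < 1` multiplies `|im|` by `s` but the
bound `re * (9 / 10 - re)` by more than `s`. Hence different boundary points lie in different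
directions from `u`. -/
theorem mem_openPetal_of_mem_segment (hf : f ≠ u) (hε : 0 < ε) (ht : t ∈ petal u f ε)
    (hz : z ∈ segment ℝ u t) (hzu : z ≠ u) (hzt : z ≠ t) : z ∈ openPetal u f ε := by
  obtain ⟨s, h0, h1, rfl⟩ := mem_segment_iff.1 hz
  have hs0 : 0 < s := h0.lt_of_ne (by rintro rfl; simp at hzu)
  have hs1 : s < 1 := h1.lt_of_ne (by rintro rfl; simp at hzt)
  have htu : t ≠ u := by
    rintro rfl
    simp at hzu
  have hre := re_pos_of_mem_petal hf hε ht htu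
  have ht' : |(coord u f t).im| ≤ ε * ((coord u f t).re * (9 / 10 - (coord u f t).re)) := ht
  change |(coord u f _).im| < _
  rw [coord_lineMap, Complex.re_ofReal_mul, Complex.im_ofReal_mul, abs_mul, abs_of_pos hs0]
  calc s * |(coord u f t).im|
      ≤ s * (ε * ((coord u f t).re * (9 / 10 - (coord u f t).re))) := by gcongr
    _ < s * (ε * ((coord u f t).re * (9 / 10 - s * (coord u f t).re))) := by
        gcongr
        nlinarith
    _ = _ := by ring

theorem mem_petal_of_mem_segment (hf : f ≠ u) (hε : 0 < ε) (ht : t ∈ petal u f ε)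
    (hz : z ∈ segment ℝ u t) : z ∈ petal u f ε := by
  by_cases hzu : z = u
  · rw [hzu]
    exact vertex_mem_petal
  by_cases hzt : z = t
  · rwa [hzt]
  exact openPetal_subset (mem_openPetal_of_mem_segment hf hε ht hz hzu hzt)

end Petal

/-! ### Two parallel arcs by a finger move. -/

/-- Points on both of two segments from the same point in different directions. -/
theorem eq_of_mem_segments {x f z z' : ℂ} {δ δ' : ℝ} (hδ : δ ≠ δ')
    (h : coord x f z = (1 + δ * Complex.I) / 2) (h' : coord x f z' = (1 + δ' * Complex.I) / 2) {y : ℂ}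
    (hy : y ∈ segment ℝ x z) (hy' : y ∈ segment ℝ x z') : y = x := by
  obtain ⟨s, -, -, rfl⟩ := mem_segment_iff.1 hy
  obtain ⟨s', -, -, heq⟩ := mem_segment_iff.1 hy'
  have h1 := congrArg (coord x f) heq
  rw [coord_lineMap, coord_lineMap, h, h'] at h1
  have h2 := congrArg Complex.re h1
  have h3 := congrArg Complex.im h1
  simp at h2 h3
  have h4 : s * (δ - δ') = 0 := by
    have : s = s' := by linarith
    subst this
    linarith
  have h5 : s = 0 := (mul_eq_zero.1 h4).resolve_right (sub_ne_zero.2 hδ)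
  simp [h5]

/-- An arc in the complement of a closed set `K` that ends at `u` and `x` with straight segments
away from the other segments of `K` can be replaced by two parallel arcs. -/
theorem exists_parallel_arcs {K M F F' : Set ℂ} (hK : IsClosed K) {u x f f' : ℂ} {r : ℝ} (hr : 0 < r)
    (hux : 2 * r < dist u x) (hf : dist f u = r) (hf' : dist f' x = r) (hM : IsArc M f f')
    (hMu : ∀ z ∈ M, dist z u ≤ r → z = f) (hMx : ∀ z ∈ M, dist z x ≤ r → z = f')
    (hMK : ∀ z ∈ M, z ∉ K) (hF : F.Finite) (hF' : F'.Finite) (hfF : f ∉ F) (hfF' : f' ∉ F')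
    (hd : ∀ d ∈ F, dist d u = r) (hd' : ∀ d ∈ F', dist d x = r)
    (hKu : ∀ z ∈ K, dist z u ≤ r → z = u ∨ ∃ d ∈ F, z ∈ segment ℝ u d)
    (hKx : ∀ z ∈ K, dist z x ≤ r → z = x ∨ ∃ d ∈ F', z ∈ segment ℝ x d) :
    ∃ A B : Set ℂ, IsArc A u x ∧ IsArc B u x ∧ (∀ z ∈ A, z ∈ K → z = u ∨ z = x) ∧
      (∀ z ∈ B, z ∈ K → z = u ∨ z = x) ∧ ∀ z ∈ A, z ∈ B → z = u ∨ z = x := by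
  -- A thin petal at `u` is stretched along the arc by a homeomorphism `h` until its image, a
  -- finger, contains the midpoint `q` of the segment from `x` to `f'`. Two slightly different
  -- segments then run from `x` to the finger, and are continued to `u` inside it by images of
  -- straight segments.
  subst hf
  have hfu : f ≠ u := dist_pos.1 hr
  have hfx : f' ≠ x := dist_pos.1 (hf' ▸ hr)
  obtain ⟨ε, ⟨⟨hcu, hcx⟩, hε0, hε1⟩⟩ := (((eventually_cone_free hF hfu hfF hd).and
    (eventually_cone_free hF' hfx hfF' fun d hd => (hd' d hd).trans hf'.symm)).and
    (Ioo_mem_nhdsGT (show (0 : ℝ) < 1 / 2 by norm_num))).exists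
  have freeU : ∀ z ∈ K, dist z u ≤ dist f u → 0 < (coord u f z).re →
      ¬ |(coord u f z).im| ≤ ε * (coord u f z).re := by
    intro z hz hzu hre
    rcases hKu z hz hzu with rfl | ⟨d, hd, hz⟩
    · simp [coord] at hre
    · exact hcu d hd z hz hre
  have freeX : ∀ z ∈ K, dist z x ≤ dist f u → 0 < (coord x f' z).re →
      ¬ |(coord x f' z).im| ≤ ε * (coord x f' z).re := by
    intro z hz hzu hre
    rcases hKx z hz hzu with rfl | ⟨d, hd, hz⟩
    · simp [coord] at hre
    · exact hcx d hd z hz hre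
  have hfar : ∀ z, dist z u ≤ dist f u → dist f u < dist z x := by
    intro z hz
    have := dist_triangle u z x
    rw [dist_comm u z] at this
    linarith
  -- the two ends of the arc
  have seg : ∀ {o g z : ℂ}, g ≠ o → z ∈ segment ℝ (o + ((1 / 2 : ℝ) : ℂ) * (g - o)) g →
      0 < (coord o g z).re ∧ (coord o g z).im = 0 ∧ dist g o / 2 ≤ dist z o ∧ dist z o ≤ dist g o := by
    intro o g z hg hz
    obtain ⟨s, hs0, hs1, rfl⟩ := mem_segment_iff.1 hz
    have h1 : o + ((1 / 2 : ℝ) : ℂ) * (g - o) + s * (g - (o + ((1 / 2 : ℝ) : ℂ) * (g - o))) =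
        o + ((1 / 2 + s / 2 : ℝ) : ℂ) * (g - o) := by
      push_cast
      ring
    have h2 : coord o g g = 1 := div_self (sub_ne_zero.2 hg)
    rw [h1, dist_eq_norm_coord (z := o + ((1 / 2 + s / 2 : ℝ) : ℂ) * (g - o)) hg, coord_lineMap, h2, mul_one, Complex.norm_real,
      Real.norm_eq_abs, abs_of_pos (by positivity)]
    have h3 := dist_nonneg (x := g) (y := o)
    refine ⟨by rw [Complex.ofReal_re]; positivity, Complex.ofReal_im _, ?_, ?_⟩ <;> nlinarith
  set p := u + ((1 / 2 : ℝ) : ℂ) * (f - u) with hp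
  set q := x + ((1 / 2 : ℝ) : ℂ) * (f' - x) with hq
  let U : Set ℂ := (K ∪ Metric.closedBall u (dist f u / 4) ∪ Metric.closedBall x (dist f u / 4))ᶜ
  have hU : IsOpen U :=
    ((hK.union Metric.isClosed_closedBall).union Metric.isClosed_closedBall).isOpen_compl
  have memU : ∀ z, z ∉ K → dist f u / 4 < dist z u → dist f u / 4 < dist z x → z ∈ U := by
    rintro z h1 h2 h3 ((h | h) | h)
    · exact h1 h
    · exact absurd (Metric.mem_closedBall.1 h) (not_le.2 h2)
    · exact absurd (Metric.mem_closedBall.1 h) (not_le.2 h3)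
  let C : Set ℂ := segment ℝ p f ∪ M ∪ segment ℝ q f'
  have hC : IsPreconnected C := by
    refine IsPreconnected.union f' (Or.inr hM.right_mem) (right_mem_segment ℝ _ _) ?_
      (convex_segment _ _).isPreconnected
    exact IsPreconnected.union f (right_mem_segment ℝ _ _) hM.left_mem
      (convex_segment _ _).isPreconnected hM.isPreconnected
  have hCU : C ⊆ U := by
    rintro z ((hz | hz) | hz)
    · obtain ⟨h1, h2, h3, h4⟩ := seg hfu hz
      refine memU z (fun hzK => freeU z hzK h4 h1 ?_) (by linarith) (by linarith [hfar z h4])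
      rw [h2, abs_zero]
      positivity
    · refine memU z (hMK z hz) ?_ ?_
      · by_contra h
        have h1 : dist z u ≤ dist f u := by linarith
        rw [hMu z hz h1] at h
        linarith
      · by_contra h
        have h1 : dist z x ≤ dist f u := by linarith
        rw [hMx z hz h1, hf'] at h
        linarith
    · obtain ⟨h1, h2, h3, h4⟩ := seg hfx hz
      rw [hf'] at h3 h4
      refine memU z (fun hzK => freeX z hzK h4 h1 ?_) ?_ (by linarith)
      · rw [h2, abs_zero]
        positivity
      · by_contra h
        linarith [hfar z (by linarith)]
  -- `h` fixes `K` and discs around `u` and `x` and moves `p` to `q`; a point of the petal that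
  -- lands outside `U` has therefore not moved (`hfix`).
  obtain ⟨h, hid, hpq⟩ := exists_homeomorph_of_isPreconnected hU hC hCU (p := p) (q := q)
    (Or.inl (Or.inl (left_mem_segment ℝ _ _))) (Or.inr (left_mem_segment ℝ _ _))
  have hfix : ∀ z, h z ∉ U → h z = z := fun z hz => h.injective (hid _ hz)
  have hhu : h u = u := hid u fun hu => hu (Or.inl (Or.inr
    (Metric.mem_closedBall_self (by positivity))))
  -- the image of the petal
  let T := h '' petal u f ε
  have hT : IsClosed T := h.isClosed_image.2 isClosed_petal
  have hTK : ∀ z ∈ T, z ∈ K → z = u := by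
    rintro _ ⟨z, hz, rfl⟩ hzK
    have h1 := hfix z fun hzU => hzU (Or.inl (Or.inl hzK))
    rw [h1] at hzK ⊢
    by_contra hzu
    exact freeU z hzK (dist_le_of_mem_petal hfu hε0 hε1.le hz) (re_pos_of_mem_petal hfu hε0 hz hzu)
      (abs_im_le_of_mem_petal hε0 hz)
  have hxT : x ∉ T := by
    rintro ⟨z, hz, hzx⟩
    have h1 := hfix z (by
      rw [hzx]
      exact fun hxU => hxU (Or.inr (Metric.mem_closedBall_self (by positivity))))
    have h2 := hfar z (dist_le_of_mem_petal hfu hε0 hε1.le hz)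
    rw [← h1, hzx, dist_self] at h2
    linarith
  have hqT : h '' openPetal u f ε ∈ 𝓝 q := by
    refine (h.isOpenMap _ isOpen_openPetal).mem_nhds ⟨p, ?_, hpq⟩
    have h2 : coord u f f = 1 := div_self (sub_ne_zero.2 hfu)
    change |(coord u f p).im| < _
    rw [hp, coord_lineMap, h2, mul_one, Complex.ofReal_re, Complex.ofReal_im, abs_zero]
    exact mul_pos hε0 (by norm_num)
  -- an arc for each small angle `δ` at `x`
  let qd : ℝ → ℂ := fun δ => x + (1 + δ * Complex.I) / 2 * (f' - x)
  have hqd : ∀ δ, coord x f' (qd δ) = (1 + δ * Complex.I) / 2 := fun δ => by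
    have := sub_ne_zero.2 hfx
    simp only [qd, coord]
    field_simp
    ring
  have hnear : ∀ᶠ δ : ℝ in 𝓝[>] 0, qd δ ∈ h '' openPetal u f ε := by
    have h1 : Tendsto qd (𝓝[>] 0) (𝓝 (qd 0)) :=
      Continuous.continuousWithinAt (by simp only [qd]; fun_prop)
    have h2 : qd 0 = q := by
      simp [qd, hq]
    rw [h2] at h1
    exact h1 hqT
  have harc : ∀ δ, 0 < δ → δ < ε → qd δ ∈ h '' openPetal u f ε →
      ∃ t ∈ petal u f ε, t ∉ openPetal u f ε ∧ t ≠ u ∧ ∃ B ⊆ segment ℝ (qd δ) x,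
        IsArc (h '' segment ℝ u t ∪ B) u x ∧ (∀ z ∈ B, z ∈ T → z = h t) ∧ h t ∈ B ∧
        ∀ z ∈ B, z ∈ K → z = x := by
    intro δ hδ hδε hδT
    have hcone : ∀ z ∈ segment ℝ (qd δ) x, z ≠ x → dist z x ≤ dist f u ∧ 0 < (coord x f' z).re ∧
        |(coord x f' z).im| ≤ ε * (coord x f' z).re := by
      intro z hz hzx
      rw [segment_symm] at hz
      obtain ⟨s, h0, h1, rfl⟩ := mem_segment_iff.1 hz
      have hs0 : 0 < s := h0.lt_of_ne (by rintro rfl; simp at hzx)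
      have h2 : coord x f' (x + s * (qd δ - x)) = ((s / 2 : ℝ) : ℂ) * (1 + δ * Complex.I) := by
        rw [coord_lineMap, hqd]
        push_cast
        ring
      refine ⟨?_, ?_, ?_⟩
      · rw [dist_eq_norm_coord hfx, hf', h2, norm_mul, Complex.norm_real, Real.norm_eq_abs,
          abs_of_pos (by positivity)]
        refine mul_le_of_le_one_left dist_nonneg ?_
        have h3 : ‖1 + δ * Complex.I‖ ≤ 2 := by
          refine (norm_add_le _ _).trans ?_
          rw [norm_one, norm_mul, Complex.norm_I, mul_one, Complex.norm_real, Real.norm_eq_abs,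
            abs_of_pos hδ]
          linarith
        nlinarith [norm_nonneg (1 + δ * Complex.I)]
      · rw [h2, Complex.re_ofReal_mul]
        simp
        positivity
      · rw [h2, Complex.re_ofReal_mul, Complex.im_ofReal_mul]
        rw [abs_mul, abs_of_pos (half_pos hs0)]
        simp [abs_of_pos hδ]
        nlinarith
    have hqx : qd δ ≠ x := fun hqx => by
      have h1 := hqd δ
      rw [hqx] at h1
      have := congrArg Complex.re h1
      simp [coord] at this
    -- `qd δ` is inside the finger and `x` is not: `B` is the part of the segment after its last
    -- exit from the finger, at a boundary point.
    obtain ⟨t', B, ht', hB, hBarc, hBT⟩ := (IsArc.segment hqx).exists_lastExit hT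
      (image_mono openPetal_subset hδT) hxT
    have ht'T : t' ∈ T := hT.frontier_subset ht'
    obtain ⟨t, ht, rfl⟩ := ht'T
    have htx : h t ≠ x := fun h1 => hxT (h1 ▸ ⟨t, ht, rfl⟩)
    have htu : t ≠ u := by
      rintro rfl
      have h1 := (hcone _ (hB hBarc.left_mem) htx).1
      rw [hhu] at h1
      linarith
    refine ⟨t, ht, fun h1 => ?_, htu, B, hB, ?_, hBT, hBarc.left_mem, ?_⟩
    · refine ht'.2 (interior_maximal (image_mono openPetal_subset)
        (h.isOpenMap _ isOpen_openPetal) ⟨t, h1, rfl⟩)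
    · have h1 := (IsArc.segment htu.symm).image h.continuous.continuousOn h.injective.injOn
      rw [hhu] at h1
      refine h1.trans hBarc ?_
      rintro _ ⟨z, hz, rfl⟩ hzB
      exact hBT _ hzB ⟨z, mem_petal_of_mem_segment hfu hε0 ht hz, rfl⟩
    · intro z hz hzK
      by_contra hzx
      obtain ⟨h1, h2, h3⟩ := hcone z (hB hz) hzx
      exact freeX z hzK h1 h2 h3
  obtain ⟨δ, ⟨hδT, hδ0, hδε⟩⟩ := (hnear.and (Ioo_mem_nhdsGT hε0)).exists
  obtain ⟨δ', ⟨hδT', hδ0', hδδ⟩⟩ := (hnear.and (Ioo_mem_nhdsGT hδ0)).exists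
  obtain ⟨t, ht, hto, htu, B, hB, hA, hBT, htB, hBK⟩ := harc δ hδ0 hδε hδT
  obtain ⟨t', ht', hto', htu', B', hB', hA', hBT', htB', hBK'⟩ := harc δ' hδ0' (hδδ.trans hδε) hδT'
  have hBB : ∀ z ∈ B, z ∈ B' → z = x := by
    intro z hz hz'
    have h1 := hB hz
    have h2 := hB' hz'
    rw [segment_symm] at h1 h2
    exact eq_of_mem_segments hδδ.ne' (hqd δ) (hqd δ') h1 h2
  -- A common exit point would be a common point of the two segments, hence `x`, which is not in the
  -- finger.
  have htt : t ≠ t' := by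
    rintro rfl
    exact hxT (hBB _ htB htB' ▸ ⟨t, ht, rfl⟩)
  have hray : ∀ {a b : ℂ}, a ∈ petal u f ε → b ∉ openPetal u f ε → b ≠ u → a ≠ b →
      b ∉ segment ℝ u a :=
    fun ha hb hbu hab hmem => hb (mem_openPetal_of_mem_segment hfu hε0 ha hmem hbu hab.symm)
  have hmeet : ∀ z ∈ segment ℝ u t, z ∈ segment ℝ u t' → z = u := by
    intro z hz hz'
    by_contra hzu
    obtain ⟨s, hs0, hs1, rfl⟩ := mem_segment_iff.1 hz
    obtain ⟨s', hs0', hs1', heq⟩ := mem_segment_iff.1 hz'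
    have hs : 0 < s := hs0.lt_of_ne (by rintro rfl; simp at hzu)
    have hs' : 0 < s' := hs0'.lt_of_ne (by rintro rfl; rw [heq] at hzu; simp at hzu)
    have hsC : (s : ℂ) ≠ 0 := by exact_mod_cast hs.ne'
    have hsC' : (s' : ℂ) ≠ 0 := by exact_mod_cast hs'.ne'
    rcases le_total s s' with hle | hle
    · refine hray ht hto' htu' htt (mem_segment_iff.2 ⟨s / s', by positivity,
        (div_le_one hs').2 hle, ?_⟩)
      push_cast
      field_simp
      linear_combination -heq
    · refine hray ht' hto htu htt.symm (mem_segment_iff.2 ⟨s' / s, by positivity,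
        (div_le_one hs).2 hle, ?_⟩)
      push_cast
      field_simp
      linear_combination heq
  have hAK : ∀ {a : ℂ} {B : Set ℂ}, a ∈ petal u f ε → (∀ z ∈ B, z ∈ K → z = x) →
      ∀ z ∈ h '' segment ℝ u a ∪ B, z ∈ K → z = u ∨ z = x := by
    rintro a B ha hBK z (⟨y, hy, rfl⟩ | hz) hzK
    · exact Or.inl (hTK _ ⟨y, mem_petal_of_mem_segment hfu hε0 ha hy, rfl⟩ hzK)
    · exact Or.inr (hBK z hz hzK)
  have hcross : ∀ {a b : ℂ} {B : Set ℂ}, a ∈ petal u f ε → b ∉ openPetal u f ε → b ≠ u → a ≠ b →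
      (∀ z ∈ B, z ∈ T → z = h b) → ∀ z ∈ segment ℝ u a, h z ∉ B := by
    intro a b B ha hb hbu hab hBT z hz hzB
    have h1 := h.injective (hBT _ hzB ⟨z, mem_petal_of_mem_segment hfu hε0 ha hz, rfl⟩)
    exact hray ha hb hbu hab (h1 ▸ hz)
  refine ⟨_, _, hA, hA', hAK ht hBK, hAK ht' hBK', ?_⟩
  rintro z (⟨y, hy, rfl⟩ | hz) (⟨y', hy', hyy⟩ | hz')
  · obtain rfl := h.injective hyy
    left
    rw [hmeet _ hy hy', hhu]
  · exact absurd hz' (hcross ht hto' htu' htt hBT' y hy)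
  · subst hyy
    exact absurd hz (hcross ht' hto htu htt.symm hBT y' hy')
  · exact Or.inr (hBB z hz hz')

/-! ### Straightening a drawing near its vertices. -/

/-- The middle parts of the edges of a drawing between small discs around the vertices: the edge `e`
leaves the disc around its end `u` at the point `foot e u`. -/
structure Radial {V E : Type*} {S : Set V} {ends : E → Sym2 V} (D : Drawing S ends) where
  r : ℝ
  foot : E → V → ℂ
  mid : E → Set ℂ
  r_pos : 0 < r
  lt_dist : ∀ v ∈ S, ∀ w ∈ S, v ≠ w → 2 * r < dist (D.pt v) (D.pt w)
  isArc_mid : ∀ e u v, ends e = s(u, v) → IsArc (mid e) (foot e u) (foot e v)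
  dist_foot : ∀ e, ∀ u ∈ ends e, dist (foot e u) (D.pt u) = r
  mid_outside : ∀ e, ∀ z ∈ mid e, ∀ w ∈ S, dist z (D.pt w) ≤ r → w ∈ ends e ∧ z = foot e w
  mid_disjoint : ∀ e f, e ≠ f → ∀ z ∈ mid e, z ∉ mid f

theorem dist_le_of_mem_segment {p q z : ℂ} (hz : z ∈ segment ℝ p q) : dist z p ≤ dist q p := by
  obtain ⟨s, h0, h1, rfl⟩ := mem_segment_iff.1 hz
  rw [Complex.dist_eq, Complex.dist_eq, add_sub_cancel_left, norm_mul, Complex.norm_real,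
    Real.norm_eq_abs, abs_of_nonneg h0]
  exact mul_le_of_le_one_left (norm_nonneg _) h1

theorem eq_or_eq_of_mem_segments {p q q' z : ℂ} (hq : dist q p = dist q' p)
    (hz : z ∈ segment ℝ p q) (hz' : z ∈ segment ℝ p q') : z = p ∨ q = q' := by
  obtain ⟨s, h0, -, rfl⟩ := mem_segment_iff.1 hz
  obtain ⟨s', h0', -, heq⟩ := mem_segment_iff.1 hz'
  rw [Complex.dist_eq, Complex.dist_eq] at hq
  have h1 : s * ‖q - p‖ = s' * ‖q - p‖ := by
    have := congrArg norm (add_left_cancel heq)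
    rw [norm_mul, norm_mul, Complex.norm_real, Complex.norm_real, Real.norm_eq_abs,
      Real.norm_eq_abs, abs_of_nonneg h0, abs_of_nonneg h0', ← hq] at this
    exact this
  by_cases hqp : q - p = 0
  · left
    rw [hqp, mul_zero, add_zero]
  have h2 : s = s' := mul_right_cancel₀ (norm_ne_zero_iff.2 hqp) h1
  subst h2
  by_cases hs : s = 0
  · left
    simp [hs]
  · right
    have := mul_left_cancel₀ (Complex.ofReal_ne_zero.2 hs) (add_left_cancel heq)
    exact sub_left_inj.1 this

namespace Drawing

variable {V E : Type*} {S : Set V} {ends : E → Sym2 V}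

/-- The radius is small enough for the discs to be disjoint and to miss non-incident arcs. Each arc
is cut after its last exit from the disc at one end, and the rest is cut in the same way, in
reverse, at the other end. -/
theorem exists_radial [Finite V] [Finite E] (D : Drawing S ends) : Nonempty (Radial D) := by
  classical
  have h1 : ∀ᶠ r : ℝ in 𝓝[>] 0, ∀ v w, v ∈ S → w ∈ S → v ≠ w → 2 * r < dist (D.pt v) (D.pt w) := by
    refine eventually_all.2 fun v => eventually_all.2 fun w => ?_
    by_cases h : v ∈ S ∧ w ∈ S ∧ v ≠ w
    · have : 0 < dist (D.pt v) (D.pt w) := dist_pos.2 fun h' => h.2.2 (D.injOn h.1 h.2.1 h')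
      filter_upwards [Ioo_mem_nhdsGT (half_pos this)] with r hr _ _ _
      linarith [hr.2]
    · exact Eventually.of_forall fun r h1 h2 h3 => absurd ⟨h1, h2, h3⟩ h
  have h2 : ∀ᶠ r : ℝ in 𝓝[>] 0, ∀ e w, w ∈ S → w ∉ ends e → ∀ z ∈ D.arc e, r < dist z (D.pt w) := by
    refine eventually_all.2 fun e => eventually_all.2 fun w => ?_
    by_cases h : w ∈ S ∧ w ∉ ends e
    · have hc : IsClosed (D.arc e) := by
        obtain ⟨u, v, huv⟩ : ∃ u v, ends e = s(u, v) := by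
          induction ends e with
          | h u v => exact ⟨u, v, rfl⟩
        exact (D.isArc e u v huv).isCompact.isClosed
      filter_upwards [eventually_lt_dist_of_isClosed hc fun h' => h.2 (D.mem_ends e w h.1 h')]
        with r hr _ _ using hr
    · exact Eventually.of_forall fun r h1 h2 => absurd ⟨h1, h2⟩ h
  obtain ⟨r, ⟨h1, h2⟩, hr⟩ := ((h1.and h2).and self_mem_nhdsWithin).exists
  have hr : 0 < r := hr
  have h3 : ∀ e, ∃ (foot : V → ℂ) (M : Set ℂ), M ⊆ D.arc e ∧
      (∀ u v, ends e = s(u, v) → IsArc M (foot u) (foot v)) ∧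
      (∀ u ∈ ends e, dist (foot u) (D.pt u) = r) ∧
      ∀ z ∈ M, ∀ w ∈ S, dist z (D.pt w) ≤ r → w ∈ ends e ∧ z = foot w := by
    intro e
    obtain ⟨u, v, huv⟩ : ∃ u v, ends e = s(u, v) := by
      induction ends e with
      | h u v => exact ⟨u, v, rfl⟩
    have hA := D.isArc e u v huv
    have hne : v ≠ u := fun h => hA.ne (by rw [h])
    have huS : u ∈ S := D.ends_mem e u (by simp [huv])
    have hvS : v ∈ S := D.ends_mem e v (by simp [huv])
    have hd := h1 v u hvS huS hne
    obtain ⟨f, B, hf, hBA, hB, hBf⟩ := hA.exists_lastExit (K := Metric.closedBall (D.pt u) r)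
      Metric.isClosed_closedBall (Metric.mem_closedBall_self hr.le)
      (fun h => by linarith [Metric.mem_closedBall.1 h])
    have hf : dist f (D.pt u) = r := Metric.frontier_closedBall_subset_sphere hf
    obtain ⟨g, M, hg, hMB, hM, hMg⟩ := hB.symm.exists_lastExit (K := Metric.closedBall (D.pt v) r)
      Metric.isClosed_closedBall (Metric.mem_closedBall_self hr.le) (fun h => by
        have := dist_triangle_left (D.pt v) (D.pt u) f
        linarith [Metric.mem_closedBall.1 h])
    have hg : dist g (D.pt v) = r := Metric.frontier_closedBall_subset_sphere hg
    -- The value `g` matters only at `w = v`; feet at vertices off the edge are never used.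
    refine ⟨fun w => if w = u then f else g, M, hMB.trans hBA, ?_, ?_, ?_⟩
    · intro a b hab
      rw [huv] at hab
      rcases Sym2.eq_iff.1 hab with ⟨rfl, rfl⟩ | ⟨rfl, rfl⟩
      · simpa [hne] using hM.symm
      · simpa [hne] using hM
    · intro w hw
      rw [huv] at hw
      rcases Sym2.mem_iff.1 hw with rfl | rfl
      · simpa using hf
      · simpa [hne] using hg
    · intro z hz w hw hzw
      have hwe : w ∈ ends e := by
        by_contra h
        linarith [h2 e w hw h z (hBA (hMB hz))]
      refine ⟨hwe, ?_⟩
      rw [huv] at hwe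
      rcases Sym2.mem_iff.1 hwe with rfl | rfl
      · simpa using hBf z (hMB hz) hzw
      · simpa [hne] using hMg z hz hzw
  choose foot mid hsub harc hdist hout using h3
  refine ⟨⟨r, foot, mid, hr, fun v hv w hw => h1 v w hv hw, harc, hdist, hout, ?_⟩⟩
  intro e f hef z hz hz'
  obtain ⟨w, hw, -, rfl⟩ := D.inter e f hef z (hsub e hz) (hsub f hz')
  have h4 := hout e _ hz w (D.ends_mem e w hw) (by simpa using hr.le)
  have h5 := hdist e w hw
  rw [← h4.2, dist_self] at h5
  exact hr.ne h5

end Drawing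

namespace Radial

variable {V E : Type*} {S : Set V} {ends : E → Sym2 V} {D : Drawing S ends} (R : Radial D)

/-- The arcs of the drawing that is straight near the vertices. -/
def arc (e : E) : Set ℂ := R.mid e ∪ {z | ∃ w ∈ ends e, z ∈ segment ℝ (D.pt w) (R.foot e w)}

theorem foot_mem {e : E} {w : V} (hw : w ∈ ends e) : R.foot e w ∈ R.mid e := by
  obtain ⟨v, hv⟩ := hw
  exact (R.isArc_mid e w v hv).left_mem

theorem eq_of_dist_le {z : ℂ} {v w : V} (hv : v ∈ S) (hw : w ∈ S) (h : dist z (D.pt v) ≤ R.r)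
    (h' : dist z (D.pt w) ≤ R.r) : v = w := by
  by_contra hvw
  have h1 := R.lt_dist v hv w hw hvw
  have := dist_triangle_left (D.pt v) (D.pt w) z
  linarith

theorem dist_le {e : E} {w : V} (hw : w ∈ ends e) {z : ℂ}
    (hz : z ∈ segment ℝ (D.pt w) (R.foot e w)) : dist z (D.pt w) ≤ R.r :=
  (dist_le_of_mem_segment hz).trans (R.dist_foot e w hw).le

/-- Near a vertex the new arcs are radii, so all intersections there can be decided by comparing
feet. -/
theorem mem_segment_of_mem_arc {e : E} {z : ℂ} (hz : z ∈ R.arc e) {w : V} (hw : w ∈ S)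
    (h : dist z (D.pt w) ≤ R.r) : w ∈ ends e ∧ z ∈ segment ℝ (D.pt w) (R.foot e w) := by
  rcases hz with hz | ⟨v, hv, hz⟩
  · obtain ⟨h1, rfl⟩ := R.mid_outside e z hz w hw h
    exact ⟨h1, right_mem_segment ℝ _ _⟩
  · obtain rfl := R.eq_of_dist_le (D.ends_mem e v hv) hw (R.dist_le hv hz) h
    exact ⟨hv, hz⟩

theorem isArc_arc {e : E} {u v : V} (he : ends e = s(u, v)) :
    IsArc (R.arc e) (D.pt u) (D.pt v) := by
  have hu : u ∈ ends e := by simp [he]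
  have hv : v ∈ ends e := by simp [he]
  have hne : u ≠ v := fun h => (D.isArc e u v he).ne (by rw [h])
  have huS := D.ends_mem e u hu
  have hvS := D.ends_mem e v hv
  have hs : ∀ w ∈ ends e, D.pt w ≠ R.foot e w := fun w hw h => by
    have := R.dist_foot e w hw
    rw [← h, dist_self] at this
    exact R.r_pos.ne this
  have h1 := (IsArc.segment (hs u hu)).trans (R.isArc_mid e u v he) fun z hz hz' =>
    (R.mid_outside e z hz' u huS (R.dist_le hu hz)).2
  have h2 := h1.trans (IsArc.segment (hs v hv)).symm (by
    rintro z (hz | hz) hz'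
    · exact absurd (R.eq_of_dist_le huS hvS (R.dist_le hu hz) (R.dist_le hv hz')) hne
    · exact (R.mid_outside e z hz v hvS (R.dist_le hv hz')).2)
  convert h2 using 1
  ext z
  simp only [arc, he, Sym2.mem_iff, exists_eq_or_imp, exists_eq_left, mem_union, mem_ofPred_eq]
  tauto

/-- The drawing that is straight near the vertices. -/
def drawing : Drawing S ends where
  pt := D.pt
  arc := R.arc
  ends_mem := D.ends_mem
  injOn := D.injOn
  isArc _ _ _ he := R.isArc_arc he
  mem_ends e w hw h := (R.mem_segment_of_mem_arc h hw (by simpa using R.r_pos.le)).1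
  inter := by
    have key : ∀ e f, e ≠ f → ∀ z ∈ R.arc e, ∀ w ∈ ends f, z ∈ segment ℝ (D.pt w) (R.foot f w) →
        w ∈ ends e ∧ w ∈ ends f ∧ z = D.pt w := by
      intro e f hef z hz w hw hzw
      obtain ⟨h1, h2⟩ := R.mem_segment_of_mem_arc hz (D.ends_mem f w hw) (R.dist_le hw hzw)
      refine ⟨h1, hw, (eq_or_eq_of_mem_segments ?_ h2 hzw).resolve_right fun h => ?_⟩
      · rw [R.dist_foot e w h1, R.dist_foot f w hw]
      · exact R.mid_disjoint e f hef _ (R.foot_mem h1) (h ▸ R.foot_mem hw)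
    rintro e f hef z (hz | ⟨w, hw, hz⟩) (hz' | ⟨w', hw', hz'⟩)
    · exact absurd hz' (R.mid_disjoint e f hef z hz)
    · exact ⟨w', key e f hef z (Or.inl hz) w' hw' hz'⟩
    · obtain ⟨h1, h2, h3⟩ := key f e hef.symm z (Or.inl hz') w hw hz
      exact ⟨w, h2, h1, h3⟩
    · exact ⟨w', key e f hef z (Or.inr ⟨w, hw, hz⟩) w' hw' hz'⟩

end Radial

/-! ### Doubling an edge. -/

namespace Drawing

variable {V E : Type*} [Finite V] [Finite E] {S : Set V} {ends : E → Sym2 V}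

open Classical in
/-- An edge of a drawing can be doubled. -/
theorem exists_double (D₀ : Drawing S ends) (e₀ : E) :
    Nonempty (Drawing S (fun o : Option E => o.elim (ends e₀) ends)) := by
  obtain ⟨R⟩ := D₀.exists_radial
  obtain ⟨u, x, he₀⟩ : ∃ u v, ends e₀ = s(u, v) := by
    induction ends e₀ with
    | h u v => exact ⟨u, v, rfl⟩
  let D := R.drawing
  have hu : u ∈ ends e₀ := by simp [he₀]
  have hx : x ∈ ends e₀ := by simp [he₀]
  have hne : u ≠ x := fun h => (D.isArc e₀ u x he₀).ne (by rw [h])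
  have huS := D.ends_mem _ _ hu
  have hxS := D.ends_mem _ _ hx
  -- The obstacles for the two copies of `e₀`: all other arcs and all vertices.
  let K : Set ℂ := (⋃ e : {e // e ≠ e₀}, D.arc e) ∪ D.pt '' S
  have hK : IsClosed K := by
    refine IsClosed.union (isClosed_iUnion_of_finite fun e => ?_) ((toFinite S).image _).isClosed
    obtain ⟨a, b, hab⟩ : ∃ u v, ends e = s(u, v) := by
      induction ends e.1 with
      | h u v => exact ⟨u, v, rfl⟩
    exact (D.isArc e a b hab).isCompact.isClosed
  let F : V → Set ℂ := fun w => (fun e => R.foot e w) '' {e | e ≠ e₀ ∧ w ∈ ends e}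
  have hF : ∀ w, (F w).Finite := fun w => (toFinite _).image _
  have hfF : ∀ w ∈ ends e₀, R.foot e₀ w ∉ F w := by
    rintro w hw ⟨e, ⟨he, hwe⟩, h⟩
    have h : R.foot e w = R.foot e₀ w := h
    exact R.mid_disjoint e e₀ he _ (R.foot_mem hwe) (h ▸ R.foot_mem hw)
  have hd : ∀ w, ∀ d ∈ F w, dist d (D.pt w) = R.r := by
    rintro w _ ⟨e, ⟨-, hwe⟩, rfl⟩
    exact R.dist_foot e w hwe
  have hKw : ∀ w ∈ S, ∀ z ∈ K, dist z (D.pt w) ≤ R.r →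
      z = D.pt w ∨ ∃ d ∈ F w, z ∈ segment ℝ (D.pt w) d := by
    rintro w hw z (hz | ⟨v, hv, rfl⟩) hzw
    · obtain ⟨⟨e, he⟩, hz⟩ := mem_iUnion.1 hz
      obtain ⟨h1, h2⟩ := R.mem_segment_of_mem_arc hz hw hzw
      exact Or.inr ⟨_, ⟨e, ⟨he, h1⟩, rfl⟩, h2⟩
    · left
      rw [R.eq_of_dist_le (z := D₀.pt v) hv hw (by simpa using R.r_pos.le) hzw]
  have hMK : ∀ z ∈ R.mid e₀, z ∉ K := by
    rintro z hz (hzK | ⟨v, hv, rfl⟩)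
    · obtain ⟨⟨e, he⟩, hzK⟩ := mem_iUnion.1 hzK
      rcases hzK with hzK | ⟨w, hw, hzK⟩
      · exact R.mid_disjoint e e₀ he z hzK hz
      · obtain ⟨h1, rfl⟩ := R.mid_outside e₀ z hz w (D.ends_mem e w hw) (R.dist_le hw hzK)
        have h2 := R.dist_foot e₀ w h1
        rcases eq_or_eq_of_mem_segments ((R.dist_foot e w hw).trans h2.symm) hzK
          (right_mem_segment ℝ _ _) with h | h
        · rw [h, dist_self] at h2
          exact R.r_pos.ne h2
        · exact R.mid_disjoint e e₀ he _ (R.foot_mem hw) (h ▸ hz)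
    · obtain ⟨h1, h2⟩ := R.mid_outside e₀ _ hz v hv (by
        change dist (D₀.pt v) (D₀.pt v) ≤ R.r
        simpa using R.r_pos.le)
      have h3 := R.dist_foot e₀ v h1
      rw [← h2] at h3
      change dist (D₀.pt v) (D₀.pt v) = R.r at h3
      rw [dist_self] at h3
      exact R.r_pos.ne h3
  obtain ⟨A, B, hA, hB, hAK, hBK, hAB⟩ := exists_parallel_arcs hK R.r_pos
    (R.lt_dist u huS x hxS hne) (R.dist_foot e₀ u hu) (R.dist_foot e₀ x hx) (R.isArc_mid e₀ u x he₀)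
    (fun z hz h => (R.mid_outside e₀ z hz u huS h).2)
    (fun z hz h => (R.mid_outside e₀ z hz x hxS h).2) hMK (hF u) (hF x) (hfF u hu) (hfF x hx)
    (hd u) (hd x) (hKw u huS) (hKw x hxS)
  let D₁ : Drawing S (fun e : {e // e ≠ e₀} => ends e) :=
    D.comap Subtype.val Subtype.val_injective (fun _ => rfl) subset_rfl fun e => D.ends_mem e
  have hvert : ∀ {A : Set ℂ}, (∀ z ∈ A, z ∈ K → z = D₀.pt u ∨ z = D₀.pt x) → ∀ w ∈ S,
      D₀.pt w ∈ A → w = u ∨ w = x := fun hAK w hw hwA =>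
    (hAK _ hwA (Or.inr ⟨w, hw, rfl⟩)).imp (D.injOn hw huS) (D.injOn hw hxS)
  have hedge : ∀ {A : Set ℂ}, (∀ z ∈ A, z ∈ K → z = D₀.pt u ∨ z = D₀.pt x) →
      ∀ e : {e // e ≠ e₀}, ∀ z ∈ D₁.arc e, z ∈ A → ∃ w ∈ ends e, z = D₁.pt w := by
    intro A hAK e z hz hzA
    rcases hAK z hzA (Or.inl (mem_iUnion.2 ⟨e, hz⟩)) with rfl | rfl
    · exact ⟨u, D.mem_ends e u huS hz, rfl⟩
    · exact ⟨x, D.mem_ends e x hxS hz, rfl⟩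
  let D₂ := D₁.addEdge huS hxS hA (hvert hAK) (hedge hAK)
  let D₃ := D₂.addEdge huS hxS hB (hvert hBK) (by
    rintro (_ | e) z hz hzB
    · rcases hAB z hz hzB with rfl | rfl
      · exact ⟨u, by simp, rfl⟩
      · exact ⟨x, by simp, rfl⟩
    · exact hedge hBK e z hz hzB)
  -- The arc `B` becomes the extra copy, `A` takes the place of `e₀`, and the other edges keep their
  -- arcs.
  let φ : Option E → Option (Option {e // e ≠ e₀}) := fun o =>
    o.elim none fun e => some (if h : e = e₀ then none else some ⟨e, h⟩)
  have hφ : ∀ o, (φ o).elim s(u, x) (fun o' => o'.elim s(u, x) fun e : {e // e ≠ e₀} => ends e) =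
      o.elim (ends e₀) ends := by
    rintro (_ | e)
    · exact he₀.symm
    · by_cases h : e = e₀
      · simp [φ, h, he₀]
      · simp [φ, h]
  refine ⟨D₃.comap φ ?_ hφ subset_rfl ?_⟩
  · rintro (_ | e) (_ | f) h
    · rfl
    · simp [φ] at h
    · simp [φ] at h
    · by_cases h1 : e = e₀ <;> by_cases h2 : f = e₀
      · rw [h1, h2]
      · simp [φ, h1, h2] at h
      · simp [φ, h1, h2] at h
      · simpa [φ, h1, h2] using h
  · rintro (_ | e)
    · exact D.ends_mem e₀
    · exact D.ends_mem e

end Drawing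

/-! ### Sums of planar graphs at a common vertex. -/

section Sums

variable {V : Type*} [Finite V] {H : SimpleGraph V} {S T : Set V}

/-- Supplies a copy of `xu` for the 2-sum to consume, separate from the edges of `H`. If `xu` is an
edge of `H` it has to be doubled; otherwise the added edge itself is that copy. -/
theorem PlanarOn.exists_drawing_option {u x : V} (h : PlanarOn S (H ⊔ SimpleGraph.edge u x))
    (hux : u ≠ x) (hu : u ∈ S) (hx : x ∈ S) :
    Nonempty (Drawing S (fun o : Option (EdgesIn H S) => o.elim s(x, u) Subtype.val)) := by
  by_cases hadj : H.Adj x u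
  · have hle : PlanarOn S H := h.mono subset_rfl fun a _ b _ hab => Or.inl hab
    obtain ⟨D⟩ := hle
    exact D.exists_double ⟨s(x, u), hadj, by
      intro w hw
      rcases Sym2.mem_iff.1 hw with rfl | rfl <;> assumption⟩
  · obtain ⟨D⟩ := h
    have hmem : ∀ w ∈ s(x, u), w ∈ S := by
      intro w hw
      rcases Sym2.mem_iff.1 hw with rfl | rfl <;> assumption
    have hxu : s(x, u) ∈ (H ⊔ SimpleGraph.edge u x).edgeSet := by
      rw [SimpleGraph.mem_edgeSet, SimpleGraph.sup_adj, SimpleGraph.edge_adj]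
      exact Or.inr ⟨Or.inr ⟨rfl, rfl⟩, hux.symm⟩
    let φ : Option (EdgesIn H S) → EdgesIn (H ⊔ SimpleGraph.edge u x) S := fun o =>
      o.elim ⟨s(x, u), hxu, hmem⟩ fun e =>
        ⟨e.1, SimpleGraph.edgeSet_mono le_sup_left e.2.1, e.2.2⟩
    refine ⟨D.comap φ ?_ ?_ subset_rfl ?_⟩
    · rintro (_ | e) (_ | f) hef
      · rfl
      · have h1 : s(x, u) = f.1 := congrArg (fun g => g.1) hef
        exact absurd ((SimpleGraph.mem_edgeSet H).1 (h1.symm ▸ f.2.1)) hadj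
      · have h1 : e.1 = s(x, u) := congrArg (fun g => g.1) hef
        exact absurd ((SimpleGraph.mem_edgeSet H).1 (h1 ▸ e.2.1)) hadj
      · have h1 : e.1 = f.1 := congrArg (fun g => g.1) hef
        rw [Subtype.ext h1]
    · rintro (_ | e) <;> rfl
    · rintro (_ | e)
      · exact hmem
      · exact e.2.2

theorem PlanarOn.oneSum {x : V} (hS : PlanarOn S H) (hT : PlanarOn T H) (hST : S ∩ T = {x})
    (hcross : ∀ u ∈ S, ∀ v ∈ T, H.Adj u v → u ∈ T ∨ v ∈ S) : PlanarOn (S ∪ T) H := by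
  obtain ⟨D⟩ := hS
  obtain ⟨D'⟩ := hT
  obtain ⟨D''⟩ := D.exists_oneSum D' hST
  refine PlanarOn.of_drawing D'' subset_rfl ?_
  intro e
  induction e with
  | h u v =>
    intro he hw
    have key : (u ∈ S ∧ v ∈ S) ∨ (u ∈ T ∧ v ∈ T) := by
      rcases hw u (by simp) with hu | hu <;> rcases hw v (by simp) with hv | hv
      · exact Or.inl ⟨hu, hv⟩
      · exact (hcross u hu v hv he).symm.imp (fun h => ⟨hu, h⟩) (fun h => ⟨h, hv⟩)
      · exact (hcross v hv u hu (H.adj_symm he)).symm.imp (fun h => ⟨h, hv⟩) (fun h => ⟨hu, h⟩)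
      · exact Or.inr ⟨hu, hv⟩
    rcases key with ⟨hu, hv⟩ | ⟨hu, hv⟩
    · exact ⟨Sum.inl ⟨s(u, v), he, by
        intro w hw
        rcases Sym2.mem_iff.1 hw with rfl | rfl <;> assumption⟩, rfl⟩
    · exact ⟨Sum.inr ⟨s(u, v), he, by
        intro w hw
        rcases Sym2.mem_iff.1 hw with rfl | rfl <;> assumption⟩, rfl⟩

theorem PlanarOn.twoSum {x u v : V} (hS : PlanarOn S (H ⊔ SimpleGraph.edge u x))
    (hT : PlanarOn T (H ⊔ SimpleGraph.edge x v)) (hST : S ∩ T = {x}) (hu : u ∈ S) (hv : v ∈ T)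
    (hcross : ∀ a ∈ S, ∀ b ∈ T, H.Adj a b → a ∈ T ∨ b ∈ S) :
    PlanarOn (S ∪ T) (H ⊔ SimpleGraph.edge u v) := by
  have hxS : x ∈ S := (hST.ge rfl).1
  have hxT : x ∈ T := (hST.ge rfl).2
  have hinter : ∀ {w}, w ∈ S → w ∈ T → w = x := fun h h' => hST.le ⟨h, h'⟩
  -- Then the edge `uv` is the edge `xv` already present on the side of `T`, and a 1-sum suffices;
  -- similarly for `v = x`.
  by_cases hux : u = x
  · subst hux
    refine PlanarOn.oneSum (x := u) ?_ hT hST ?_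
    · refine hS.mono subset_rfl fun a ha b hb hab => ?_
      rcases hab with hab | hab
      · exact Or.inl hab
      · rw [SimpleGraph.edge_adj] at hab
        rcases hab with ⟨⟨rfl, rfl⟩ | ⟨rfl, rfl⟩, hne⟩
        · exact absurd (hinter hb hv).symm hne
        · exact absurd (hinter ha hv) hne
    · rintro a ha b hb (hab | hab)
      · exact hcross a ha b hb hab
      · rw [SimpleGraph.edge_adj] at hab
        rcases hab with ⟨⟨rfl, rfl⟩ | ⟨rfl, rfl⟩, hne⟩
        · exact Or.inl hxT
        · exact Or.inr hxS
  by_cases hvx : v = x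
  · subst hvx
    refine PlanarOn.oneSum (x := v) hS ?_ hST ?_
    · refine hT.mono subset_rfl fun a ha b hb hab => ?_
      rcases hab with hab | hab
      · exact Or.inl hab
      · rw [SimpleGraph.edge_adj] at hab
        rcases hab with ⟨⟨rfl, rfl⟩ | ⟨rfl, rfl⟩, hne⟩
        · exact absurd (hinter hu ha) hne
        · exact absurd (hinter hu hb) (Ne.symm hne)
    · rintro a ha b hb (hab | hab)
      · exact hcross a ha b hb hab
      · rw [SimpleGraph.edge_adj] at hab
        rcases hab with ⟨⟨rfl, rfl⟩ | ⟨rfl, rfl⟩, hne⟩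
        · exact Or.inr hxS
        · exact Or.inl hxT
  obtain ⟨D⟩ := hS.exists_drawing_option hux hu hxS
  obtain ⟨D'⟩ := PlanarOn.exists_drawing_option (u := v) (x := x) (H := H)
    (by rwa [SimpleGraph.edge_comm]) hvx hv hxT
  obtain ⟨D''⟩ := D.exists_twoSum D' hST rfl rfl
  refine PlanarOn.of_drawing D'' subset_rfl ?_
  intro e
  induction e with
  | h a b =>
    intro he hw
    rcases he with he | he
    · have key : (a ∈ S ∧ b ∈ S) ∨ (a ∈ T ∧ b ∈ T) := by
        rcases hw a (by simp) with ha | ha <;> rcases hw b (by simp) with hb | hb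
        · exact Or.inl ⟨ha, hb⟩
        · exact (hcross a ha b hb he).symm.imp (fun h => ⟨ha, h⟩) (fun h => ⟨h, hb⟩)
        · exact (hcross b hb a ha (H.adj_symm he)).symm.imp (fun h => ⟨h, hb⟩) (fun h => ⟨ha, h⟩)
        · exact Or.inr ⟨ha, hb⟩
      rcases key with ⟨ha, hb⟩ | ⟨ha, hb⟩
      · exact ⟨some (Sum.inl ⟨s(a, b), he, by
          intro w hw
          rcases Sym2.mem_iff.1 hw with rfl | rfl <;> assumption⟩), rfl⟩
      · exact ⟨some (Sum.inr ⟨s(a, b), he, by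
          intro w hw
          rcases Sym2.mem_iff.1 hw with rfl | rfl <;> assumption⟩), rfl⟩
    · rw [SimpleGraph.edge_adj] at he
      refine ⟨none, ?_⟩
      rcases he.1 with ⟨rfl, rfl⟩ | ⟨rfl, rfl⟩
      · rfl
      · exact Sym2.eq_swap

end Sums

/-! ### Replacing a path by an edge. -/

section Paths

variable {V : Type*} {H : SimpleGraph V} {S : Set V}

/-- The first arc meets the arcs of the remaining path only in vertices, and its starting vertex
does not recur, so it can be concatenated. -/
theorem Drawing.isArc_path (D : Drawing univ (Subtype.val : EdgesIn H univ → Sym2 V)) {x y : V}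
    (p : H.Walk x y) (hp : p.IsPath) (hxy : x ≠ y) :
    IsArc {z | ∃ e : EdgesIn H univ, e.1 ∈ p.edges ∧ z ∈ D.arc e} (D.pt x) (D.pt y) := by
  induction p with
  | nil => exact absurd rfl hxy
  | @cons u v w h p ih =>
    rw [SimpleGraph.Walk.cons_isPath_iff] at hp
    let e₀ : EdgesIn H univ := ⟨s(u, v), h, fun _ _ => mem_univ _⟩
    have h1 := D.isArc e₀ u v rfl
    by_cases hvw : v = w
    · subst hvw
      obtain rfl := SimpleGraph.Walk.eq_nil_iff_nil.2 (SimpleGraph.Walk.isPath_iff_nil.1 hp.1)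
      convert h1 using 1
      ext z
      constructor
      · rintro ⟨e, he, hz⟩
        have : e = e₀ := Subtype.ext (by simpa using he)
        exact this ▸ hz
      · intro hz
        exact ⟨e₀, by simp [e₀], hz⟩
    · have h2 := h1.trans (ih hp.1 hvw) (by
        rintro z hz ⟨e, he, hze⟩
        have hne : e₀ ≠ e := by
          rintro rfl
          exact hp.2 (p.fst_mem_support_of_mem_edges he)
        obtain ⟨a, ha, hae, rfl⟩ := D.inter e₀ e hne z hz hze
        have has : a ∈ p.support := p.mem_support_of_mem_edges he hae
        rcases Sym2.mem_iff.1 ha with rfl | rfl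
        · exact absurd has hp.2
        · rfl)
      convert h2 using 1
      ext z
      constructor
      · rintro ⟨e, he, hz⟩
        rw [SimpleGraph.Walk.edges_cons, List.mem_cons] at he
        rcases he with he | he
        · have : e = e₀ := Subtype.ext he
          exact Or.inl (this ▸ hz)
        · exact Or.inr ⟨e, he, hz⟩
      · rintro (hz | ⟨e, he, hz⟩)
        · exact ⟨e₀, by simp [e₀], hz⟩
        · exact ⟨e, by simp [he], hz⟩

/-- A path with inner vertices outside of `S` can be replaced by an edge. -/
theorem PlanarOn.suppress (hH : PlanarOn univ H) {x y : V} (hx : x ∈ S) (hy : y ∈ S) (hxy : x ≠ y)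
    (p : H.Walk x y) (hp : p.IsPath) (hpS : ∀ w ∈ p.support, w ∈ S → w = x ∨ w = y) :
    PlanarOn S (H ⊔ SimpleGraph.edge x y) := by
  by_cases hadj : H.Adj x y
  · refine hH.mono (subset_univ S) fun u _ v _ huv => ?_
    rcases huv with huv | huv
    · exact huv
    · rw [SimpleGraph.edge_adj] at huv
      rcases huv.1 with ⟨rfl, rfl⟩ | ⟨rfl, rfl⟩
      · exact hadj
      · exact hadj.symm
  obtain ⟨D⟩ := hH
  have hA := D.isArc_path p hp hxy
  let D' : Drawing S (Subtype.val : EdgesIn H S → Sym2 V) :=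
    D.comap (fun e => ⟨e.1, e.2.1, fun _ _ => mem_univ _⟩)
      (fun e f hef => Subtype.ext (congrArg (fun g => g.1) hef)) (fun _ => rfl) (subset_univ S)
      fun e => e.2.2
  refine PlanarOn.of_drawing (D'.addEdge hx hy hA ?_ ?_) subset_rfl ?_
  · rintro w hw ⟨e, he, hz⟩
    exact hpS w (p.mem_support_of_mem_edges he (D.mem_ends e w (mem_univ w) hz)) hw
  · rintro e z hz ⟨f, hf, hzf⟩
    have hne : (⟨e.1, e.2.1, fun _ _ => mem_univ _⟩ : EdgesIn H univ) ≠ f := by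
      -- An edge of `H[S]` on the path would have both ends in `{x, y}`; it would be a loop or the
      -- edge `xy`, which `hadj` excludes.
      rintro rfl
      have hends : ∀ w ∈ e.1, w = x ∨ w = y := fun w hw =>
        hpS w (p.mem_support_of_mem_edges hf hw) (e.2.2 w hw)
      obtain ⟨a, b, hab⟩ : ∃ a b, e.1 = s(a, b) := by
        induction e.1 with
        | h a b => exact ⟨a, b, rfl⟩
      have he : H.Adj a b := (SimpleGraph.mem_edgeSet H).1 (hab ▸ e.2.1)
      rw [hab] at hends
      rcases hends a (Sym2.mem_mk_left a b) with rfl | rfl <;>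
        rcases hends b (Sym2.mem_mk_right a b) with rfl | rfl
      · exact H.irrefl he
      · exact hadj he
      · exact hadj he.symm
      · exact H.irrefl he
    obtain ⟨w, hw, -, h⟩ := D.inter _ f hne z hz hzf
    exact ⟨w, hw, h⟩
  · intro e
    induction e with
    | h u v =>
      intro he hw
      rcases he with he | he
      · exact ⟨some ⟨s(u, v), he, hw⟩, rfl⟩
      · rw [SimpleGraph.edge_adj] at he
        refine ⟨none, ?_⟩
        rcases he.1 with ⟨rfl, rfl⟩ | ⟨rfl, rfl⟩
        · rfl
        · exact Sym2.eq_swap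

end Paths

/-! ### Connectivity inside vertex sets, and blocks. -/

/-- `u` and `v` are joined by a walk of `G` in `S`. -/
def ConnIn {V : Type*} (G : SimpleGraph V) (S : Set V) (u v : V) : Prop :=
  ∃ p : G.Walk u v, ∀ w ∈ p.support, w ∈ S

section Blocks

variable {V : Type*} {G G' : SimpleGraph V} {S T B B' : Set V} {u v w c : V}

namespace ConnIn

theorem refl (h : u ∈ S) : ConnIn G S u u := ⟨.nil, by simpa using h⟩

theorem symm (h : ConnIn G S u v) : ConnIn G S v u := by
  obtain ⟨p, hp⟩ := h
  exact ⟨p.reverse, by simpa using hp⟩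

theorem trans (h : ConnIn G S u v) (h' : ConnIn G S v w) : ConnIn G S u w := by
  obtain ⟨p, hp⟩ := h
  obtain ⟨q, hq⟩ := h'
  refine ⟨p.append q, fun x hx => ?_⟩
  exact ((SimpleGraph.Walk.mem_support_append_iff p q).1 hx).elim (hp x) (hq x)

theorem of_adj (h : G.Adj u v) (hu : u ∈ S) (hv : v ∈ S) : ConnIn G S u v :=
  ⟨h.toWalk, by simp [hu, hv]⟩

theorem mono (h : ConnIn G S u v) (hG : G ≤ G') (hS : S ⊆ T) : ConnIn G' T u v := by
  obtain ⟨p, hp⟩ := h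
  exact ⟨p.mapLe hG, by simpa using fun x hx => hS (hp x hx)⟩

theorem left_mem (h : ConnIn G S u v) : u ∈ S := by
  obtain ⟨p, hp⟩ := h
  exact hp u p.start_mem_support

theorem right_mem (h : ConnIn G S u v) : v ∈ S := h.symm.left_mem

theorem exists_path (h : ConnIn G S u v) :
    ∃ p : G.Walk u v, p.IsPath ∧ ∀ w ∈ p.support, w ∈ S := by
  classical
  obtain ⟨p, hp⟩ := h
  exact ⟨p.bypass, p.bypass_isPath, fun w hw => hp w (p.support_bypass_subset_support hw)⟩

theorem exists_walk_of_induce {u v : S} (p : (G.induce S).Walk u v) :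
    ∃ q : G.Walk u v, ∀ w ∈ q.support, ∃ h : w ∈ S, (⟨w, h⟩ : S) ∈ p.support := by
  induction p with
  | @nil u => exact ⟨.nil, fun w hw => by
      obtain rfl : w = u := by simpa using hw
      exact ⟨u.2, by simp⟩⟩
  | @cons a b _ h p ih =>
    obtain ⟨q, hq⟩ := ih
    have hab : G.Adj a b := h
    refine ⟨q.cons hab, fun w hw => ?_⟩
    rw [SimpleGraph.Walk.support_cons, List.mem_cons] at hw
    rcases hw with rfl | hw
    · exact ⟨a.2, by simp⟩
    · obtain ⟨h1, h2⟩ := hq w hw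
      exact ⟨h1, by simp [h2]⟩

theorem induce_reachable_iff (hu : u ∈ S) (hv : v ∈ S) :
    (G.induce S).Reachable ⟨u, hu⟩ ⟨v, hv⟩ ↔ ConnIn G S u v := by
  constructor
  · rintro ⟨p⟩
    obtain ⟨q, hq⟩ := exists_walk_of_induce p
    exact ⟨q, fun w hw => (hq w hw).1⟩
  · rintro ⟨p, hp⟩
    exact ⟨p.induce S hp⟩

theorem induce_iff {u v w : S} :
    ConnIn (G.induce S) {w}ᶜ u v ↔ ConnIn G (S \ {w.1}) u.1 v.1 := by
  constructor
  · rintro ⟨p, hp⟩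
    obtain ⟨q, hq⟩ := exists_walk_of_induce p
    refine ⟨q, fun x hx => ?_⟩
    obtain ⟨h1, h2⟩ := hq x hx
    exact ⟨h1, fun h => hp _ h2 (Subtype.ext h)⟩
  · rintro ⟨p, hp⟩
    refine ⟨p.induce S fun x hx => (hp x hx).1, fun x hx => ?_⟩
    rw [SimpleGraph.Walk.support_induce] at hx
    have hx' : x.1 ∈ p.support := by simpa using hx
    exact fun h => (hp x.1 hx').2 (congrArg Subtype.val h)

end ConnIn

theorem connIn_support (p : G.Walk u v) (hw : w ∈ p.support) :
    ConnIn G {x | x ∈ p.support} w u := by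
  classical
  refine ConnIn.symm ⟨p.takeUntil w hw, fun x hx => p.support_takeUntil_subset_support hw hx⟩

/-- A vertex of a path is joined to an end of the path outside of any other vertex. -/
theorem connIn_path_diff (p : G.Walk u v) (hp : p.IsPath) {x : V} (hx : x ∈ p.support) (hxw : x ≠ w) :
    ConnIn G ({y | y ∈ p.support} \ {w}) x u ∨ ConnIn G ({y | y ∈ p.support} \ {w}) x v := by
  induction p with
  | nil =>
    obtain rfl : x = _ := by simpa using hx
    exact Or.inl (ConnIn.refl ⟨hx, hxw⟩)
  | @cons a b t h p ih =>
    rw [SimpleGraph.Walk.cons_isPath_iff] at hp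
    have hsub : {y | y ∈ p.support} ⊆ {y | y ∈ (p.cons h).support} := fun y hy => by
      simp [show y ∈ p.support from hy]
    rw [SimpleGraph.Walk.support_cons, List.mem_cons] at hx
    rcases hx with rfl | hx
    · exact Or.inl (ConnIn.refl ⟨by simp, hxw⟩)
    · by_cases haw : a = w
      · right
        have h1 : {y | y ∈ p.support} ⊆ {y | y ∈ (p.cons h).support} \ {w} := fun y hy =>
          ⟨hsub hy, by
            rintro rfl
            exact hp.2 (haw ▸ hy)⟩
        exact ((connIn_support p hx).trans (connIn_support p p.end_mem_support).symm).mono le_rfl h1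
      · refine (ih hp.1 hx).imp (fun h1 => ?_) fun h1 => h1.mono le_rfl (sdiff_subset_sdiff_left hsub)
        have h2 := h1.mono (le_refl G) (sdiff_subset_sdiff_left (t := {w}) hsub)
        exact h2.trans (ConnIn.of_adj h.symm h2.right_mem ⟨by simp, haw⟩)

/-- Allowing `w ∉ S` in the last condition costs nothing, as it then only asks for connectivity. -/
theorem isBiconnected_induce_iff : IsBiconnected (G.induce S) ↔ S.Nonempty ∧
    (∀ u ∈ S, ∀ v ∈ S, ConnIn G S u v) ∧
    ∀ w, ∀ u ∈ S, ∀ v ∈ S, u ≠ w → v ≠ w → ConnIn G (S \ {w}) u v := by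
  have key : ∀ (w u v : S) (hu : u ∈ ({w}ᶜ : Set S)) (hv : v ∈ ({w}ᶜ : Set S)),
      ((G.induce S).induce ({w}ᶜ : Set S)).Reachable ⟨u, hu⟩ ⟨v, hv⟩ ↔
        ConnIn G (S \ {w.1}) u.1 v.1 := fun w u v hu hv =>
    (ConnIn.induce_reachable_iff hu hv).trans ConnIn.induce_iff
  constructor
  · rintro ⟨hc, hcut⟩
    have h1 : ∀ u ∈ S, ∀ v ∈ S, ConnIn G S u v := fun u hu v hv =>
      (ConnIn.induce_reachable_iff hu hv).1 (hc.preconnected _ _)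
    refine ⟨?_, h1, fun w u hu v hv huw hvw => ?_⟩
    · obtain ⟨x⟩ := hc.nonempty
      exact ⟨x.1, x.2⟩
    · by_cases hw : w ∈ S
      · by_contra h
        have hu' : (⟨u, hu⟩ : S) ∈ ({⟨w, hw⟩}ᶜ : Set S) := fun h => huw (congrArg Subtype.val h)
        have hv' : (⟨v, hv⟩ : S) ∈ ({⟨w, hw⟩}ᶜ : Set S) := fun h => hvw (congrArg Subtype.val h)
        exact hcut ⟨w, hw⟩ ⟨⟨u, hu⟩, ⟨v, hv⟩, hu', hv', hc.preconnected _ _, fun hr =>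
          h ((key ⟨w, hw⟩ _ _ hu' hv').1 hr)⟩
      · rw [sdiff_singleton_eq_self hw]
        exact h1 u hu v hv
  · rintro ⟨⟨x, hx⟩, h1, h2⟩
    refine ⟨?_, ?_⟩
    · have : Nonempty S := ⟨⟨x, hx⟩⟩
      exact ⟨fun u v => (ConnIn.induce_reachable_iff u.2 v.2).2 (h1 u u.2 v v.2)⟩
    · rintro w ⟨u, v, hu, hv, -, hr⟩
      exact hr ((key w u v hu hv).2 (h2 w u u.2 v v.2 (fun h => hu (Subtype.ext h))
        fun h => hv (Subtype.ext h)))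

theorem isBiconnected_of_hub (hS : ∃ t ∈ S, ∀ y ∈ S, ConnIn G S y t)
    (h : ∀ w, ∃ t, ∀ y ∈ S, y ≠ w → ConnIn G (S \ {w}) y t) : IsBiconnected (G.induce S) := by
  obtain ⟨t, htS, ht⟩ := hS
  refine isBiconnected_induce_iff.2 ⟨⟨t, htS⟩, fun u hu v hv => (ht u hu).trans (ht v hv).symm, ?_⟩
  intro w u hu v hv huw hvw
  obtain ⟨t, ht⟩ := h w
  exact (ht u hu huw).trans (ht v hv hvw).symm

theorem IsBlock.connIn (hB : IsBlock G B) (hu : u ∈ B) (hv : v ∈ B) : ConnIn G B u v :=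
  (isBiconnected_induce_iff.1 hB.prop).2.1 u hu v hv

theorem IsBlock.connIn_diff (hB : IsBlock G B) (hu : u ∈ B) (hv : v ∈ B) (huw : u ≠ w)
    (hvw : v ≠ w) : ConnIn G (B \ {w}) u v :=
  (isBiconnected_induce_iff.1 hB.prop).2.2 w u hu v hv huw hvw

theorem IsBlock.nonempty (hB : IsBlock G B) : B.Nonempty := (isBiconnected_induce_iff.1 hB.prop).1

/-- A common vertex of two blocks separates them. -/
theorem IsBlock.not_connIn (hB : IsBlock G B) (hB' : IsBlock G B') (hne : B ≠ B') (hc : c ∈ B)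
    (hc' : c ∈ B') (hu : u ∈ B) (huc : u ≠ c) (hv : v ∈ B') (hvc : v ≠ c) :
    ¬ ConnIn G {c}ᶜ u v := by
  intro h
  obtain ⟨p, hp, hpc⟩ := h.exists_path
  let P : Set V := {y | y ∈ p.support}
  let X : Set V := B ∪ B' ∪ P
  have hBX : B ⊆ X := fun y hy => Or.inl (Or.inl hy)
  have hBX' : B' ⊆ X := fun y hy => Or.inl (Or.inr hy)
  have hPX : P ⊆ X := fun y hy => Or.inr hy
  -- A path between the two blocks that avoids `c` would make their union with it biconnected. The
  -- hub is `c`, or `u` once `c` is deleted.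
  have hX : IsBiconnected (G.induce X) := by
    refine isBiconnected_of_hub ⟨c, hBX hc, ?_⟩ fun w => ?_
    · rintro y ((hy | hy) | hy)
      · exact (hB.connIn hy hc).mono le_rfl hBX
      · exact (hB'.connIn hy hc').mono le_rfl hBX'
      · exact ((connIn_support p hy).mono le_rfl hPX).trans ((hB.connIn hu hc).mono le_rfl hBX)
    · by_cases hwc : w = c
      · subst hwc
        have hPw : P ⊆ X \ {w} := fun y hy => ⟨hPX hy, hpc y hy⟩
        refine ⟨u, ?_⟩
        rintro y ((hy | hy) | hy) hyw
        · exact (hB.connIn_diff hy hu hyw huc).mono le_rfl (sdiff_subset_sdiff_left hBX)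
        · exact ((hB'.connIn_diff hy hv hyw hvc).mono le_rfl (sdiff_subset_sdiff_left hBX')).trans
            ((connIn_support p p.end_mem_support).mono le_rfl hPw)
        · exact (connIn_support p hy).mono le_rfl hPw
      · refine ⟨c, ?_⟩
        have h1 : ∀ y ∈ B, y ≠ w → ConnIn G (X \ {w}) y c := fun y hy hyw =>
          (hB.connIn_diff hy hc hyw (Ne.symm hwc)).mono le_rfl (sdiff_subset_sdiff_left hBX)
        have h2 : ∀ y ∈ B', y ≠ w → ConnIn G (X \ {w}) y c := fun y hy hyw =>
          (hB'.connIn_diff hy hc' hyw (Ne.symm hwc)).mono le_rfl (sdiff_subset_sdiff_left hBX')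
        rintro y ((hy | hy) | hy) hyw
        · exact h1 y hy hyw
        · exact h2 y hy hyw
        · rcases connIn_path_diff p hp hy hyw with h3 | h3
          · exact (h3.mono le_rfl (sdiff_subset_sdiff_left hPX)).trans (h1 u hu h3.right_mem.2)
          · exact (h3.mono le_rfl (sdiff_subset_sdiff_left hPX)).trans (h2 v hv h3.right_mem.2)
  have hXB : X ⊆ B := hB.2 hX hBX
  have hle : B' ⊆ B := hBX'.trans hXB
  exact hne (Subset.antisymm (hB'.2 hB.prop hle) hle)

/-- A connected set outside of a block has at most one neighbour in the block. -/
theorem IsBlock.eq_of_adj (hB : IsBlock G B) {s s' k k' : V} (hs : s ∈ B) (hs' : s' ∈ B)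
    (hk : ConnIn G Bᶜ k k') (hsk : G.Adj s k) (hsk' : G.Adj s' k') : s = s' := by
  by_contra hne
  obtain ⟨p, hp, hpB⟩ := hk.exists_path
  let P : Set V := {y | y ∈ p.support}
  let X : Set V := B ∪ P
  have hBX : B ⊆ X := fun y hy => Or.inl hy
  have hPX : P ⊆ X := fun y hy => Or.inr hy
  have hkP : k ∈ P := p.start_mem_support
  have hkP' : k' ∈ P := p.end_mem_support
  -- With two different attachments `s ≠ s'` the path would be an ear of `B`, contradicting
  -- maximality: whichever vertex is deleted, the rest still hangs together through `s` or `s'`.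
  have hX : IsBiconnected (G.induce X) := by
    refine isBiconnected_of_hub ⟨s, hBX hs, ?_⟩ fun w => ?_
    · rintro y (hy | hy)
      · exact (hB.connIn hy hs).mono le_rfl hBX
      · exact ((connIn_support p hy).mono le_rfl hPX).trans
          (ConnIn.of_adj hsk.symm (hPX hkP) (hBX hs))
    · by_cases hwB : w ∈ B
      · have hPw : P ⊆ X \ {w} := fun y hy => ⟨hPX hy, fun h => hpB y hy (h ▸ hwB)⟩
        by_cases hsw : s = w
        · have hsw' : s' ≠ w := fun h => hne (hsw.trans h.symm)
          refine ⟨s', ?_⟩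
          rintro y (hy | hy) hyw
          · exact (hB.connIn_diff hy hs' hyw hsw').mono le_rfl (sdiff_subset_sdiff_left hBX)
          · exact (((connIn_support p hy).trans (connIn_support p hkP').symm).mono le_rfl hPw).trans
              (ConnIn.of_adj hsk'.symm (hPw hkP') ⟨hBX hs', hsw'⟩)
        · refine ⟨s, ?_⟩
          rintro y (hy | hy) hyw
          · exact (hB.connIn_diff hy hs hyw hsw).mono le_rfl (sdiff_subset_sdiff_left hBX)
          · exact ((connIn_support p hy).mono le_rfl hPw).trans
              (ConnIn.of_adj hsk.symm (hPw hkP) ⟨hBX hs, hsw⟩)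
      · have hBw : B ⊆ X \ {w} := fun y hy => ⟨hBX hy, fun h => hwB (h ▸ hy)⟩
        refine ⟨s, ?_⟩
        rintro y (hy | hy) hyw
        · exact (hB.connIn hy hs).mono le_rfl hBw
        · rcases connIn_path_diff p hp hy hyw with h | h
          · exact (h.mono le_rfl (sdiff_subset_sdiff_left hPX)).trans
              (ConnIn.of_adj hsk.symm ⟨hPX hkP, h.right_mem.2⟩ (hBw hs))
          · exact ((h.mono le_rfl (sdiff_subset_sdiff_left hPX)).trans
              (ConnIn.of_adj hsk'.symm ⟨hPX hkP', h.right_mem.2⟩ (hBw hs'))).trans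
              ((hB.connIn hs' hs).mono le_rfl hBw)
  exact hpB k hkP (hB.2 hX hBX (hPX hkP))

/-- If a block of a planar graph remains planar after adding an edge, so does the graph. -/
theorem IsBlock.planarOn_univ [Finite V] (hB : IsBlock G B) (hG : PlanarOn univ G) {x y : V}
    (hx : x ∈ B) (hy : y ∈ B) (hxy : PlanarOn B (G ⊔ SimpleGraph.edge x y)) :
    PlanarOn univ (G ⊔ SimpleGraph.edge x y) := by
  -- The candidates are the unions of `B` with components of `G - B`; a maximal one that keeps the
  -- graph planar must be everything.
  obtain ⟨S, hBS, ⟨-, hS, hSH⟩, hmax⟩ := (toFinite {S : Set V | B ⊆ S ∧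
    (∀ v ∉ S, ∀ w, ConnIn G Bᶜ v w → w ∉ S) ∧
      PlanarOn S (G ⊔ SimpleGraph.edge x y)}).exists_le_maximal (a := B)
    ⟨subset_rfl, fun v _ w h => h.right_mem, hxy⟩
  have hBS : B ⊆ S := hBS
  suffices S = univ by rwa [this] at hSH
  by_contra hne
  obtain ⟨v, hv⟩ := (ne_univ_iff_exists_notMem S).1 hne
  let K : Set V := {w | ConnIn G Bᶜ v w}
  have hvK : v ∈ K := ConnIn.refl fun h => hv (hBS h)
  have hKB : ∀ w ∈ K, w ∉ B := fun w hw => hw.right_mem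
  have hKS : ∀ w ∈ K, w ∉ S := fun w hw => hS v hv w hw
  -- The only possible attachment of `K` to `B`. If `K` has no neighbour in `B`, any vertex of `B`
  -- serves for the 1-sum.
  obtain ⟨c, hcB, hc⟩ : ∃ c ∈ B, ∀ s ∈ B, ∀ k ∈ K, G.Adj s k → s = c := by
    by_cases h : ∃ c ∈ B, ∃ k ∈ K, G.Adj c k
    · obtain ⟨c, hc, k, hk, hck⟩ := h
      exact ⟨c, hc, fun s hs k' hk' hsk =>
        hB.eq_of_adj hs hc (ConnIn.trans (ConnIn.symm hk') hk) hsk hck⟩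
    · obtain ⟨c, hc⟩ := hB.nonempty
      exact ⟨c, hc, fun s hs k hk hsk => absurd ⟨s, hs, k, hk, hsk⟩ h⟩
  let T : Set V := K ∪ {c}
  have hTB : ∀ w ∈ T, w ∈ B → w = c := fun w hw hwB => hw.resolve_left fun h => hKB w h hwB
  have hST : S ∩ T = {c} := by
    ext w
    constructor
    · rintro ⟨h1, h2 | h2⟩
      · exact absurd h1 (hKS w h2)
      · exact h2
    · rintro rfl
      exact ⟨hBS hcB, Or.inr rfl⟩
  have hTH : PlanarOn T (G ⊔ SimpleGraph.edge x y) := by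
    refine hG.mono (subset_univ T) fun a ha b hb hab => ?_
    rcases hab with hab | hab
    · exact hab
    · rw [SimpleGraph.edge_adj] at hab
      obtain ⟨h1 | h1, hne⟩ := hab
      · exact absurd ((hTB a ha (h1.1 ▸ hx)).trans (hTB b hb (h1.2 ▸ hy)).symm) hne
      · exact absurd ((hTB a ha (h1.1 ▸ hy)).trans (hTB b hb (h1.2 ▸ hx)).symm) hne
  have hsum := hSH.oneSum hTH hST (by
    rintro a ha b (hb | rfl) hab
    · rcases hab with hab | hab
      · by_cases haB : a ∈ B
        · exact Or.inl (Or.inr (hc a haB b hb hab))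
        · exact absurd ha (hKS a (ConnIn.trans hb (ConnIn.of_adj hab.symm (hKB b hb) haB)))
      · rw [SimpleGraph.edge_adj] at hab
        rcases hab.1 with ⟨-, rfl⟩ | ⟨-, rfl⟩
        · exact absurd hy (hKB _ hb)
        · exact absurd hx (hKB _ hb)
    · exact Or.inr (hBS hcB))
  have hle : S ∪ T ⊆ S := hmax ⟨fun z hz => Or.inl (hBS hz), ?_, hsum⟩ subset_union_left
  · exact hv (hle (Or.inr (Or.inl hvK)))
  · rintro v' hv' w hw (hwS | hwK | rfl)
    · exact hS v' (fun h => hv' (Or.inl h)) w hw hwS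
    · exact hv' (Or.inr (Or.inl (ConnIn.trans hwK hw.symm)))
    · exact hw.right_mem hcB

end Blocks

/-! ### Chains of blocks along a path of the BC-tree. -/

section Chain

variable {V : Type*} {G : SimpleGraph V}

/-- The blocks `β 0, …, β n` form a chain, in which `d (j + 1)` is a cut vertex between `β j` and
`β (j + 1)`, with ends `d 0 ∈ β 0` and `d (n + 1) ∈ β n`. -/
structure BlockChain (G : SimpleGraph V) (n : ℕ) (d : ℕ → V) (β : ℕ → Set V) : Prop where
  isBlock : ∀ j ≤ n, IsBlock G (β j)
  mem_left : ∀ j ≤ n, d j ∈ β j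
  mem_right : ∀ j ≤ n, d (j + 1) ∈ β j
  block_ne : ∀ j < n, β j ≠ β (j + 1)
  cut_ne : ∀ i j, 1 ≤ i → i < j → j ≤ n → d i ≠ d j

namespace BlockChain

variable {n : ℕ} {d : ℕ → V} {β : ℕ → Set V}

/-- From an earlier block one can move on to `β j` through the intermediate cut vertices, each of
which differs from `d (j + 1)`. Thus separation along the chain reduces to two consecutive blocks.
-/
theorem exists_connIn_left (h : BlockChain G n d β) {j : ℕ} (hj : j + 1 ≤ n) (m : ℕ) :
    ∀ i, i + m = j → ∀ v ∈ β i, v ≠ d (j + 1) →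
      ∃ u ∈ β j, u ≠ d (j + 1) ∧ ConnIn G {d (j + 1)}ᶜ v u := by
  induction m with
  | zero =>
    rintro i rfl v hv hvd
    exact ⟨v, hv, hvd, ConnIn.refl hvd⟩
  | succ m ih =>
    intro i hi v hv hvd
    have hd : d (i + 1) ≠ d (j + 1) := h.cut_ne _ _ (by omega) (by omega) hj
    obtain ⟨u, hu, hud, hc⟩ := ih (i + 1) (by omega) _ (h.mem_left (i + 1) (by omega)) hd
    refine ⟨u, hu, hud, ConnIn.trans ?_ hc⟩
    exact ((h.isBlock i (by omega)).connIn_diff hv (h.mem_right i (by omega)) hvd hd).mono le_rfl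
      fun _ hx => hx.2

theorem exists_connIn_right (h : BlockChain G n d β) {j : ℕ} (hj : 1 ≤ j) (m : ℕ) :
    j + m ≤ n → ∀ v ∈ β (j + m), v ≠ d j → ∃ u ∈ β j, u ≠ d j ∧ ConnIn G {d j}ᶜ v u := by
  induction m with
  | zero =>
    intro _ v hv hvd
    exact ⟨v, hv, hvd, ConnIn.refl hvd⟩
  | succ m ih =>
    intro hm v hv hvd
    have hd : d (j + m + 1) ≠ d j := (h.cut_ne _ _ hj (by omega) (by omega)).symm
    obtain ⟨u, hu, hud, hc⟩ := ih (by omega) _ (h.mem_right (j + m) (by omega)) hd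
    refine ⟨u, hu, hud, ConnIn.trans ?_ hc⟩
    exact ((h.isBlock _ hm).connIn_diff hv (h.mem_left _ hm) hvd hd).mono le_rfl fun _ hx => hx.2

/-- The cut vertex `d (j + 1)` separates the blocks before it from those after it. -/
theorem not_connIn (h : BlockChain G n d β) {i j l : ℕ} (hij : i ≤ j) (hjl : j + 1 ≤ l) (hl : l ≤ n)
    {v w : V} (hv : v ∈ β i) (hvd : v ≠ d (j + 1)) (hw : w ∈ β l) (hwd : w ≠ d (j + 1)) :
    ¬ ConnIn G {d (j + 1)}ᶜ v w := by
  intro hc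
  obtain ⟨m, rfl⟩ := Nat.exists_eq_add_of_le hjl
  obtain ⟨u, hu, hud, hvu⟩ := h.exists_connIn_left (by omega : j + 1 ≤ n) (j - i) i (by omega) v hv hvd
  obtain ⟨t, ht, htd, hwt⟩ := h.exists_connIn_right (by omega : 1 ≤ j + 1) m hl w hw hwd
  exact (h.isBlock j (by omega)).not_connIn (h.isBlock (j + 1) (by omega)) (h.block_ne j (by omega))
    (h.mem_right j (by omega)) (h.mem_left (j + 1) (by omega)) hu hud ht htd
    ((hvu.symm.trans hc).trans hwt)

theorem eq_of_mem (h : BlockChain G n d β) {i j l : ℕ} (hij : i ≤ j) (hjl : j + 1 ≤ l) (hl : l ≤ n)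
    {v : V} (hv : v ∈ β i) (hw : v ∈ β l) : v = d (j + 1) := by
  by_contra hvd
  exact h.not_connIn hij hjl hl hv hvd hw hvd (ConnIn.refl hvd)

theorem planarOn_block [Finite V] (h : BlockChain G n d β) (hG : PlanarOn univ G)
    (hH : PlanarOn univ (G ⊔ SimpleGraph.edge (d 0) (d (n + 1)))) {j : ℕ} (hj : j ≤ n) :
    PlanarOn (β j) (G ⊔ SimpleGraph.edge (d j) (d (j + 1))) := by
  -- Possible only at the two ends of the chain, since `cut_ne` does not involve `d 0` and `d (n +
  -- 1)`.
  by_cases hdd : d j = d (j + 1)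
  · rw [hdd, SimpleGraph.sup_edge_self]
    exact hG.mono (subset_univ _) fun _ _ _ _ => id
  have hright : ∀ m, j + m ≤ n →
      ConnIn G ((β j)ᶜ ∪ {d (j + 1)}) (d (j + 1)) (d (j + m + 1)) := by
    intro m
    induction m with
    | zero => exact fun _ => ConnIn.refl (Or.inr rfl)
    | succ m ih =>
      intro hm
      refine (ih (by omega)).trans (ConnIn.mono ((h.isBlock (j + (m + 1)) hm).connIn
        (h.mem_left _ hm) (h.mem_right _ hm)) le_rfl fun z hz => ?_)
      by_cases hzj : z ∈ β j
      · exact Or.inr (h.eq_of_mem le_rfl (by omega) hm hzj hz)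
      · exact Or.inl hzj
  have hleft : ∀ m i, i + m = j → ConnIn G ((β j)ᶜ ∪ {d j}) (d i) (d j) := by
    intro m
    induction m with
    | zero =>
      rintro i rfl
      exact ConnIn.refl (Or.inr rfl)
    | succ m ih =>
      intro i hi
      refine ConnIn.trans (ConnIn.mono ((h.isBlock i (by omega)).connIn (h.mem_left i (by omega))
        (h.mem_right i (by omega))) le_rfl fun z hz => ?_) (ih (i + 1) (by omega))
      by_cases hzj : z ∈ β j
      · obtain ⟨j, rfl⟩ : ∃ j', j = j' + 1 := ⟨j - 1, by omega⟩
        exact Or.inr (h.eq_of_mem (by omega) le_rfl hj hz hzj)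
      · exact Or.inl hzj
  -- The detour avoids `β j` except for its ends: earlier blocks meet `β j` at most in `d j`, later
  -- ones at most in `d (j + 1)`.
  let X : Set V := (β j)ᶜ ∪ {d j, d (j + 1)}
  have h1 : ConnIn (G ⊔ SimpleGraph.edge (d 0) (d (n + 1))) X (d j) (d 0) :=
    (hleft j 0 (by omega)).symm.mono le_sup_left (union_subset_union_right _ (by simp))
  have h2 : ConnIn (G ⊔ SimpleGraph.edge (d 0) (d (n + 1))) X (d (n + 1)) (d (j + 1)) := by
    have := hright (n - j) (by omega)
    rw [show j + (n - j) = n by omega] at this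
    exact this.symm.mono le_sup_left (union_subset_union_right _ (by simp))
  have h3 : ConnIn (G ⊔ SimpleGraph.edge (d 0) (d (n + 1))) X (d 0) (d (n + 1)) := by
    by_cases h0 : d 0 = d (n + 1)
    · rw [h0]
      exact ConnIn.refl h2.left_mem
    · refine ConnIn.of_adj (Or.inr ?_) h1.right_mem h2.left_mem
      rw [SimpleGraph.edge_adj]
      exact ⟨Or.inl ⟨rfl, rfl⟩, h0⟩
  obtain ⟨p, hp, hpX⟩ := ((h1.trans h3).trans h2).exists_path
  refine (hH.suppress (h.mem_left j hj) (h.mem_right j hj) hdd p hp fun w hw hwj => ?_).mono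
    subset_rfl fun u _ v _ huv => huv.imp Or.inl id
  exact (hpX w hw).resolve_left fun h => h hwj

theorem planarOn_univ [Finite V] (h : BlockChain G n d β) (hG : PlanarOn univ G)
    (hβ : ∀ j ≤ n, PlanarOn (β j) (G ⊔ SimpleGraph.edge (d j) (d (j + 1)))) :
    PlanarOn univ (G ⊔ SimpleGraph.edge (d 0) (d (n + 1))) := by
  have hstep : ∀ j ≤ n, PlanarOn univ (G ⊔ SimpleGraph.edge (d j) (d (j + 1))) := fun j hj =>
    (h.isBlock j hj).planarOn_univ hG (h.mem_left j hj) (h.mem_right j hj) (hβ j hj)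
  suffices ∀ m ≤ n, PlanarOn univ (G ⊔ SimpleGraph.edge (d 0) (d (m + 1))) from this n le_rfl
  intro m
  induction m with
  | zero => exact fun hm => hstep 0 hm
  | succ m ih =>
    intro hm
    set x := d (m + 1)
    -- The part of `G - x` connected to the next block; `Rᶜ` and `R ∪ {x}` are the two sides of the
    -- 2-sum. By `not_connIn`, `d 0` lies on the first.
    let R : Set V := {w | w ≠ x ∧ ∃ u ∈ β (m + 1), u ≠ x ∧ ConnIn G {x}ᶜ u w}
    have hxR : x ∉ R := fun h => h.1 rfl
    have hST : Rᶜ ∩ (R ∪ {x}) = {x} := by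
      ext w
      constructor
      · rintro ⟨h1, h2⟩
        exact h2.resolve_left h1
      · rintro rfl
        exact ⟨hxR, Or.inr rfl⟩
    have huniv : Rᶜ ∪ (R ∪ {x}) = univ := by
      rw [← union_assoc, compl_union_self, univ_union]
    rw [← huniv]
    refine PlanarOn.twoSum (x := x) ((ih (by omega)).mono (subset_univ _) fun _ _ _ _ => id)
      ((hstep (m + 1) hm).mono (subset_univ _) fun _ _ _ _ => id) hST ?_ ?_ ?_
    · rintro ⟨h0, u, hu, hux, hc⟩
      exact h.not_connIn (Nat.zero_le m) le_rfl hm (h.mem_left 0 (by omega)) h0 hu hux hc.symm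
    · by_cases hdx : d (m + 1 + 1) = x
      · exact Or.inr hdx
      · exact Or.inl ⟨hdx, _, h.mem_right (m + 1) hm, hdx, ConnIn.refl hdx⟩
    · rintro a ha b (⟨hbx, u, hu, hux, hc⟩ | rfl) hab
      · by_cases hax : a = x
        · exact Or.inl (Or.inr hax)
        · exact absurd ⟨hax, u, hu, hux, hc.trans (ConnIn.of_adj hab.symm hbx hax)⟩ ha
      · exact Or.inr hxR

end BlockChain

end Chain

/-! ### Translation to planar embeddings and to the BC-tree path. -/

/-- Planarity is invariant under isomorphisms. -/
theorem IsPlanar.of_iso {V W : Type*} {G : SimpleGraph V} {H : SimpleGraph W} (e : G ≃g H)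
    (h : IsPlanar H) : IsPlanar G := by
  obtain ⟨P⟩ := h
  have hadj : ∀ s ∈ G.edgeSet, s.map e ∈ H.edgeSet := by
    intro s
    induction s with
    | h u v => exact e.map_adj_iff.2
  have hmem : ∀ (s : Sym2 V) w, e w ∈ s.map e ↔ w ∈ s := by
    intro s w
    simp [Sym2.mem_map]
  refine ⟨⟨fun v => P.point (e v), fun s => P.arc (s.map e), P.point_injective.comp e.injective,
    ?_, ?_, ?_⟩⟩
  · intro u v huv
    exact P.arc_isArc (e u) (e v) (e.map_adj_iff.2 huv)
  · intro s hs w hw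
    exact (hmem s w).1 (P.mem_of_point_mem_arc _ (hadj s hs) _ hw)
  · intro s hs t ht hst z hz
    obtain ⟨w, h1, h2, h3⟩ := P.arc_inter_arc _ (hadj s hs) _ (hadj t ht)
      (fun h => hst (Sym2.map.injective e.injective h)) z hz
    exact ⟨e.symm w, (hmem _ _).1 (by simpa using h1), (hmem _ _).1 (by simpa using h2), by simpa using h3⟩

theorem isPlanar_iff {V : Type*} {G : SimpleGraph V} : IsPlanar G ↔ PlanarOn univ G := by
  rw [← isPlanar_induce_iff]
  exact ⟨IsPlanar.of_iso (SimpleGraph.induceUnivIso G),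
    IsPlanar.of_iso (SimpleGraph.induceUnivIso G).symm⟩

theorem isPlanar_inducePlusEdge_iff {V : Type*} {G : SimpleGraph V} {B : Set V} {x y : V} :
    IsPlanar (inducePlusEdge G B x y) ↔ PlanarOn B (G ⊔ SimpleGraph.edge x y) :=
  isPlanar_induce_iff (H := G ⊔ SimpleGraph.edge x y)

theorem mem_of_bcTree_adj {V : Type*} {G : SimpleGraph V} {C : G.ConnectedComponent}
    {B : BlockNode C} {c : CutNode C} (h : (bcTree C).Adj (Sum.inl B) (Sum.inr c)) : c.1 ∈ B.1 := by
  rw [bcTree, SimpleGraph.fromRel_adj] at h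
  rcases h.2 with ⟨B', c', h1, h2, h3⟩ | ⟨B', c', h1, h2, h3⟩
  · rwa [Sum.inl.inj h1, Sum.inr.inj h2]
  · simp at h1

end PlanarBC

open PlanarBC

theorem mainTheorem6 {V : Type*} [Finite V] (G : SimpleGraph V) (hG : PlanarBC.IsPlanar G)
    (C : G.ConnectedComponent) (a b : V) (ha : a ∈ C.supp) (hb : b ∈ C.supp)
    (hab : ¬ ∃ B : Set V, PlanarBC.IsBlock G B ∧ a ∈ B ∧ b ∈ B)
    (Ba Bb : PlanarBC.BlockNode C) (haB : a ∈ Ba.1) (hbB : b ∈ Bb.1)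
    -- the path `Ba, c 0, B 0, c 1, …, B (k - 1), c k, Bb` of the BC-tree
    (p : (PlanarBC.bcTree C).Walk (Sum.inl Ba) (Sum.inl Bb)) (hp : p.IsPath)
    (k : ℕ) (hk : p.length = 2 * k + 2)
    (c : Fin (k + 1) → PlanarBC.CutNode C) (B : Fin k → PlanarBC.BlockNode C)
    (hc : ∀ i : Fin (k + 1), p.getVert (2 * (i : ℕ) + 1) = Sum.inr (c i))
    (hB : ∀ i : Fin k, p.getVert (2 * (i : ℕ) + 2) = Sum.inl (B i)) :
    PlanarBC.IsPlanar (G ⊔ SimpleGraph.edge a b) ↔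
      PlanarBC.IsPlanar (PlanarBC.inducePlusEdge G Ba.1 a (c 0).1) ∧
      PlanarBC.IsPlanar (PlanarBC.inducePlusEdge G Bb.1 (c (Fin.last k)).1 b) ∧
      ∀ i : Fin k, PlanarBC.IsPlanar
        (PlanarBC.inducePlusEdge G (B i).1 (c i.castSucc).1 (c i.succ).1) := by
  -- the blocks and the cut vertices as sequences
  let β : ℕ → Set V := fun j => Sum.elim (fun X => X.1) (fun _ => ∅) (p.getVert (2 * j))
  let d : ℕ → V := fun j => if j = 0 then a else if j = k + 2 then b else
    Sum.elim (fun _ => a) (fun x => x.1) (p.getVert (2 * (j - 1) + 1))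
  have hβ : ∀ j ≤ k + 1, ∃ X : BlockNode C, p.getVert (2 * j) = Sum.inl X := by
    intro j hj
    rcases Nat.eq_zero_or_pos j with rfl | h0
    · exact ⟨Ba, p.getVert_zero⟩
    rcases hj.eq_or_lt with rfl | h1
    · refine ⟨Bb, ?_⟩
      rw [show 2 * (k + 1) = p.length by omega]
      exact p.getVert_length
    · refine ⟨B ⟨j - 1, by omega⟩, ?_⟩
      rw [← hB ⟨j - 1, by omega⟩]
      congr 1
      simp only
      omega
  have hβ_eq : ∀ {j : ℕ} {X : BlockNode C}, p.getVert (2 * j) = Sum.inl X → β j = X.1 := by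
    intro j X h
    simp only [β, h, Sum.elim_inl]
  have hd0 : d 0 = a := if_pos rfl
  have hdk : d (k + 2) = b := by simp [d]
  have hd : ∀ i : Fin (k + 1), d (i + 1) = (c i).1 := by
    intro i
    simp [d, hc i]
    intro h
    omega
  have hadj : ∀ i < p.length, (bcTree C).Adj (p.getVert i) (p.getVert (i + 1)) :=
    fun i hi => p.adj_getVert_succ hi
  have chain : BlockChain G (k + 1) d β := by
    refine ⟨?_, ?_, ?_, ?_, ?_⟩
    · intro j hj
      obtain ⟨X, hX⟩ := hβ j hj
      rw [hβ_eq hX]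
      exact X.2.1
    · intro j hj
      obtain ⟨X, hX⟩ := hβ j hj
      rw [hβ_eq hX]
      rcases Nat.eq_zero_or_pos j with rfl | h0
      · rw [mul_zero, p.getVert_zero] at hX
        rw [hd0, ← Sum.inl.inj hX]
        exact haB
      · obtain ⟨i, rfl⟩ : ∃ i, j = i + 1 := ⟨j - 1, by omega⟩
        have h1 := hadj (2 * i + 1) (by omega)
        rw [hc ⟨i, by omega⟩, show 2 * i + 1 + 1 = 2 * (i + 1) by ring, hX] at h1
        rw [hd ⟨i, by omega⟩]
        exact mem_of_bcTree_adj h1.symm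
    · intro j hj
      obtain ⟨X, hX⟩ := hβ j hj
      rw [hβ_eq hX]
      rcases hj.eq_or_lt with rfl | h0
      · rw [show 2 * (k + 1) = p.length by omega, p.getVert_length] at hX
        rw [hdk, ← Sum.inl.inj hX]
        exact hbB
      · have h1 := hadj (2 * j) (by omega)
        rw [hc ⟨j, h0⟩, hX] at h1
        rw [hd ⟨j, h0⟩]
        exact mem_of_bcTree_adj h1
    · intro j hj h
      obtain ⟨X, hX⟩ := hβ j hj.le
      obtain ⟨Y, hY⟩ := hβ (j + 1) hj
      rw [hβ_eq hX, hβ_eq hY] at h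
      have h1 : p.getVert (2 * j) = p.getVert (2 * (j + 1)) := by
        rw [hX, hY, Subtype.ext h]
      -- A path does not repeat nodes, so consecutive blocks differ; the cut vertices below are
      -- distinct for the same reason.
      have h2 := hp.getVert_injOn (show 2 * j ≤ p.length by omega)
        (show 2 * (j + 1) ≤ p.length by omega) h1
      omega
    · intro i j hi hij hj h
      obtain ⟨i, rfl⟩ : ∃ i', i = i' + 1 := ⟨i - 1, by omega⟩
      obtain ⟨j, rfl⟩ : ∃ j', j = j' + 1 := ⟨j - 1, by omega⟩
      rw [hd ⟨i, by omega⟩, hd ⟨j, by omega⟩] at h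
      have h1 : p.getVert (2 * i + 1) = p.getVert (2 * j + 1) := by
        rw [hc ⟨i, by omega⟩, hc ⟨j, by omega⟩, Subtype.ext h]
      have h2 := hp.getVert_injOn (show 2 * i + 1 ≤ p.length by omega)
        (show 2 * j + 1 ≤ p.length by omega) h1
      omega
  have hG' := isPlanar_iff.1 hG
  have hβ0 : β 0 = Ba.1 := hβ_eq p.getVert_zero
  have hβk : β (k + 1) = Bb.1 := hβ_eq (by
    rw [show 2 * (k + 1) = p.length by omega]
    exact p.getVert_length)
  have hβi : ∀ i : Fin k, β (i + 1) = (B i).1 := fun i => hβ_eq (hB i)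
  have hdi : ∀ i : Fin k, d (i + 1) = (c i.castSucc).1 := fun i => hd i.castSucc
  have hdi' : ∀ i : Fin k, d (i + 1 + 1) = (c i.succ).1 := fun i => hd i.succ
  have hd1 : d (0 + 1) = (c 0).1 := hd 0
  have hdl : d (k + 1) = (c (Fin.last k)).1 := hd (Fin.last k)
  simp only [isPlanar_inducePlusEdge_iff]
  rw [isPlanar_iff]
  constructor
  · intro hH
    have hH' : PlanarOn univ (G ⊔ SimpleGraph.edge (d 0) (d (k + 1 + 1))) := by rwa [hd0, hdk]
    have key : ∀ j ≤ k + 1, PlanarOn (β j) (G ⊔ SimpleGraph.edge (d j) (d (j + 1))) :=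
      fun j hj => chain.planarOn_block hG' hH' hj
    refine ⟨?_, ?_, fun i => ?_⟩
    · have := key 0 (by omega)
      rwa [hβ0, hd0, hd1] at this
    · have := key (k + 1) le_rfl
      rwa [hβk, hdk, hdl] at this
    · have := key (i + 1) (by omega)
      rwa [hβi, hdi, hdi'] at this
  · rintro ⟨h1, h2, h3⟩
    have := chain.planarOn_univ hG' (by
      intro j hj
      rcases Nat.eq_zero_or_pos j with rfl | h0
      · rwa [hβ0, hd0, hd1]
      rcases hj.eq_or_lt with rfl | h4
      · rwa [hβk, hdk, hdl]
      · obtain ⟨i, rfl⟩ : ∃ i : Fin k, j = i + 1 := ⟨⟨j - 1, by omega⟩, by simp only; omega⟩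
        rw [hβi, hdi, hdi']
        exact h3 i)
    rwa [hd0, hdk] at this
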